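/- **Setting.** Let $n\ge 1$ and $Y=\lambda^\star u^\star {u^\star}^\top+W\in\mathbb R^{n\times n}$, where $\lambda^\star\in\mathbb R\setminus\{0\}$, $u^\star\in\mathbb R^n$ is a unit vector ($\|u^\star\|_2=1$), and $W$ is a symmetric random matrix whose entries on and above the diagonal are independent, symmetric about zero, of common variance $\sigma^2$ ($\sigma\ge 0$), and subgaussian with common parameter $\nu$, i.e. $\mathbb E e^{tW_{ij}}\le e^{\nu t^2/2}$ for all $t\in\mathbb R$. Put $L=\log(2n)/\log\log n$ and $$\mathcal A=\{(\log n)^{-1/2},(\log n)^{-2/2},\dots,(\log n)^{-(\lceil L\rceil-1)/2},(\log n)^{-L/2}\},$$ and $d_\infty(x,y)=\min\{\|y-x\|_\infty,\|y+x\|_\infty\}$. **Algorithm.** Input: $Y$, the noise level $\sigma$, a real number $\widehat\lambda$ (an estimate of $\lambda^\star$), and $\beta>0$. 1. If $\widehat\lambda<0$, replace $(Y,\widehat\lambda)$ by $(-Y,-\widehat\lambda)$. Let $u$ be a unit eigenvector of $Y$ for its largest eigenvalue. 2. Pick any $\widehat\alpha\in\mathcal A$ such that $\widehat I=\{i:|u_i|\ge\widehat\alpha\}$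 satisfies $|\widehat I|\ge 1/(\widehat\alpha^2\log^2 n)$ and $\{i:(1-\beta)\widehat\alpha<|u_i|<(1+\beta)\widehat\alpha\}=\emptyset$. 3. Let $Q$ be the diagonal matrix with $Q_{kk}=\operatorname{sgn}(u_k)$ for $k\in\widehat I$ and $Q_{kk}=1$ otherwise, and let $\widetilde Y=QYQ$. 4. Let $\widehat S=\big(\sum_{j,k\in\widehat I}\widetilde Y_{jk}\big)^{1/2}$ and $\widehat v_j=\big(\sum_{k\in\widehat I}\widetilde Y_{jk}\big)/(\widehat S\sqrt{\widehat\lambda})$ for all $j$. 5. Output $\widehat u$, where $\widehat u_j=u_j$ if $|u_j|\le(\sigma/\widehat\lambda)\log n$, and $\widehat u_j=Q_{jj}\widehat v_j$ otherwise. **Theorem.** For every $C_2>0$ there is a constant $C>0$, depending only on $C_2$, such that for all $0<\epsilon_0\le1$, $C_1>2400/\epsilon_0$ and $K>0$ there are $K'>0$ and $n_0$, depending only on $C_2,\epsilon_0,C_1,K$, for which the following holds. Let $n\ge n_0$ and let the setting above satisfy (i) there is an $\alpha_0\in\mathcal A$ with $\frac1{\alpha_0^2}\ge|\{i:|u^\star_i|\ge\alpha_0\}|>\frac1{\alpha_0^2\log^2n}$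 and $\{i:|u^\star_i|\in[(1-\epsilon_0)\alpha_0,(1+\epsilon_0)\alpha_0]\}=\emptyset$; (ii) $|\lambda^\star|\ge C_1\sqrt{\nu n\log n}$; (iii) $\widehat\lambda$ is a random real number (it may depend on $Y$) such that $|\widehat\lambda-\lambda^\star|\le C_2\sqrt\nu\,(\log n)^{5/2}$ with probability at least $1-Kn^{-8}\log n$. Then with probability at least $1-K'n^{-8}\log n$ the algorithm with $\beta=\epsilon_0/2$ runs through ($\widehat\lambda\ne0$, a threshold as required in step 2 exists, and the sum under the root in step 4 is positive), and for every choice of $u$ in step 1 and of $\widehat\alpha$ in step 2 its output satisfies $$d_\infty(\widehat u,u^\star)\le\frac{C\sqrt\nu\,(\log n)^{5/2}}{|\lambda^\star|}.$$ In particular, the bound does not depend on the coherence $\mu=n\|u^\star\|_\infty^2$. -/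

import Mathlib

open MeasureTheory ProbabilityTheory
open scoped NNReal ENNReal Matrix

namespace SpikedMatrix

noncomputable section

/-- `L = log (2n) / log log n`. -/
def levelExponent (n : ℕ) : ℝ :=
  Real.log (2 * n) / Real.log (Real.log n)

/-- The candidate thresholds
`{(log n)^(-1/2), (log n)^(-2/2), …, (log n)^(-(⌈L⌉ - 1)/2), (log n)^(-L/2)}`. -/
def levels (n : ℕ) : Set ℝ :=
  {a | (∃ k : ℕ, 1 ≤ k ∧ k < ⌈levelExponent n⌉₊ ∧ a = Real.log n ^ (-(k : ℝ) / 2)) ∨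
    a = Real.log n ^ (-levelExponent n / 2)}

variable {n : ℕ}

/-- The indices of the entries that are at least `a` in absolute value. -/
def largeEntries (v : Fin n → ℝ) (a : ℝ) : Finset (Fin n) :=
  Finset.univ.filter fun i => a ≤ |v i|

/-- `v` lies on the Euclidean unit sphere (the ambient norm of `Fin n → ℝ` is the sup norm). -/
def IsUnitVector (v : Fin n → ℝ) : Prop :=
  ∑ i, v i ^ 2 = 1

/-- The entry-gap condition: at some candidate threshold `a`, the number of entries of absolute
value at least `a` is at most `1/a²` and more than `1/(a² log² n)`, and no entry has absolute value
in `[(1-ε)a, (1+ε)a]`. -/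
def HasEntryGap (ε : ℝ) (v : Fin n → ℝ) : Prop :=
  ∃ a ∈ levels n,
    ((largeEntries v a).card : ℝ) ≤ 1 / a ^ 2 ∧
    1 / (a ^ 2 * Real.log n ^ 2) < ((largeEntries v a).card : ℝ) ∧
    ∀ i, |v i| ∉ Set.Icc ((1 - ε) * a) ((1 + ε) * a)

/-- The noise model: a symmetric random matrix whose entries on and above the diagonal are
independent, symmetric about zero, of variance `σ²` and subgaussian with variance proxy `ν`. -/
structure IsNoise {Ω : Type*} [MeasurableSpace Ω] (P : Measure Ω) (σ : ℝ) (ν : ℝ≥0)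
    (W : Ω → Matrix (Fin n) (Fin n) ℝ) : Prop where
  measurable : ∀ i j, Measurable fun ω => W ω i j
  symm : ∀ ω, (W ω).IsSymm
  indep : iIndepFun (fun (p : {p : Fin n × Fin n // p.1 ≤ p.2}) ω => W ω p.1.1 p.1.2) P
  law_neg : ∀ i j, P.map (fun ω => -W ω i j) = P.map (fun ω => W ω i j)
  variance_eq : ∀ i j, Var[fun ω => W ω i j; P] = σ ^ 2
  subgaussian : ∀ i j, HasSubgaussianMGF (fun ω => W ω i j) ν P

/-- The observation `Y = lam • v vᵀ + W`. -/
def observation (lam : ℝ) (v : Fin n → ℝ) (W : Matrix (Fin n) (Fin n) ℝ) :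
    Matrix (Fin n) (Fin n) ℝ :=
  lam • Matrix.vecMulVec v v + W

/-- The observation, with its sign changed if the eigenvalue estimate `lh` is negative. -/
def orient (Y : Matrix (Fin n) (Fin n) ℝ) (lh : ℝ) : Matrix (Fin n) (Fin n) ℝ :=
  if lh < 0 then -Y else Y

/-- `u` is a unit eigenvector of `A` belonging to the largest eigenvalue of `A`. -/
def IsTopEigenvector (A : Matrix (Fin n) (Fin n) ℝ) (u : Fin n → ℝ) : Prop :=
  IsUnitVector u ∧ ∃ t : ℝ, Module.End.HasEigenvector (Matrix.toLin' A) t u ∧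
    ∀ s : ℝ, Module.End.HasEigenvalue (Matrix.toLin' A) s → s ≤ t

/-- The thresholds that the algorithm may pick, given the top eigenvector `u`. -/
structure IsAdmissible (β : ℝ) (u : Fin n → ℝ) (a : ℝ) : Prop where
  mem : a ∈ levels n
  card_ge : 1 / (a ^ 2 * Real.log n ^ 2) ≤ ((largeEntries u a).card : ℝ)
  gap : ∀ i, |u i| ∉ Set.Ioo ((1 - β) * a) ((1 + β) * a)

/-- The diagonal of `Q`: the sign of `u k` on the selected indices, and `1` elsewhere. -/
def signs (u : Fin n → ℝ) (a : ℝ) (k : Fin n) : ℝ :=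
  if k ∈ largeEntries u a then Real.sign (u k) else 1

/-- The matrix `Q Y Q`, where `Y` is the oriented observation. -/
def conjugated (Y : Matrix (Fin n) (Fin n) ℝ) (lh : ℝ) (u : Fin n → ℝ) (a : ℝ) :
    Matrix (Fin n) (Fin n) ℝ :=
  Matrix.diagonal (signs u a) * orient Y lh * Matrix.diagonal (signs u a)

/-- The sum of the entries of `Q Y Q` over the selected rows and columns; its square root is the
normalization `Ŝ`. -/
def selectedSum (Y : Matrix (Fin n) (Fin n) ℝ) (lh : ℝ) (u : Fin n → ℝ) (a : ℝ) : ℝ :=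
  ∑ j ∈ largeEntries u a, ∑ k ∈ largeEntries u a, conjugated Y lh u a j k

/-- The vector `v̂`. -/
def refined (Y : Matrix (Fin n) (Fin n) ℝ) (lh : ℝ) (u : Fin n → ℝ) (a : ℝ) (j : Fin n) : ℝ :=
  (∑ k ∈ largeEntries u a, conjugated Y lh u a j k) / (√(selectedSum Y lh u a) * √|lh|)

/-- The output `û` of the algorithm on the input `Y`, `lh`, when it uses the top eigenvector `u`
and the threshold `a`. The sign of `lh` is changed together with that of `Y`, so `|lh|` appears. -/
def output (σ : ℝ) (Y : Matrix (Fin n) (Fin n) ℝ) (lh : ℝ) (u : Fin n → ℝ) (a : ℝ)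
    (j : Fin n) : ℝ :=
  if |u j| ≤ σ / |lh| * Real.log n then u j else signs u a j * refined Y lh u a j

/-- The `ℓ_∞` distance up to a global sign (`‖·‖` is the sup norm on `Fin n → ℝ`). -/
def dInf (x y : Fin n → ℝ) : ℝ :=
  min ‖y - x‖ ‖y + x‖

/-- On the input `Y`, `lh`, `σ`, `β`, the algorithm runs through, and its output is within `r` of
`v`, whatever top eigenvector and whatever admissible threshold it picks. -/
structure RunsWithin (σ β : ℝ) (Y : Matrix (Fin n) (Fin n) ℝ) (lh : ℝ) (v : Fin n → ℝ)
    (r : ℝ) : Prop where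
  estimate_ne_zero : lh ≠ 0
  exists_eigenvector : ∃ u, IsTopEigenvector (orient Y lh) u
  exists_threshold : ∀ u, IsTopEigenvector (orient Y lh) u → ∃ a, IsAdmissible β u a
  selectedSum_pos : ∀ u a, IsTopEigenvector (orient Y lh) u → IsAdmissible β u a →
    0 < selectedSum Y lh u a
  dist_le : ∀ u a, IsTopEigenvector (orient Y lh) u → IsAdmissible β u a →
    dInf (output σ Y lh u a) v ≤ r

end

end SpikedMatrix

/-! Let `v` be the signal and `t` the top eigenvalue. The equation `t u = λ⟨v,u⟩ v + W u` is
iterated into a truncated Neumann series for `u` in powers of `W/t`. With high probability `‖W‖ ≤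
B`, where `B` is of order `√(ν n log n)`, hence a small fraction of `λ`. The coefficient of `v` is
then close to `s = ±1`, and the remainder after about `log n` terms is negligible. Entry `j` of `W^k
v` is compared with power iterates from which row and column `j` of `W` have been deleted. Those
iterates are independent of row `j`, so each step adds only a term of order `√(ν log n)` times a
norm (`abs_pow_mulVec_apply_le`). The result is `|u_j - s v_j| ≤ (ε/50)|v_j| + e` with `e` of order
`√(ν log n)/λ`, free of the coherence (`IsTopEigenvector.exists_sign_abs_sub_le`).

Every candidate threshold is at least `1/√(2n)`, and `e` is small against that. A gap of `v` at `α₀`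
therefore survives as a smaller gap of `u`, so a threshold exists. Conversely, a gap of `u` at any
threshold forces the selected set and signs, up to `s`, to be those of `v`
(`largeEntries_eq_of_gap`, `sign_eq_of_close`). This removes the dependence between the data and the
selection: the selected noise sums are taken against sign vectors fixed in advance, one per
threshold, and a union bound over thresholds controls them all.

With `g` the sign vector and `A = ⟨v,g⟩`, the refined entry is, up to sign, `(λ v_j A + (Wg)_j) /
(√(λA² + gᵀWg) √λ̂)`. The cardinality condition gives `A ≥ √|I| / log n`, so every relative error is
at most of order `√ν (log n)^(5/2)/λ` (`refined_close`). Entries left unrefined are so small that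
the bound on `u_j - s v_j` already suffices. A negative spike reduces to a positive one by changing
the signs of `Y` and `λ̂`. -/

namespace SpikedMatrix

/-! ### Leave-one-out iterates, Neumann series and top eigenvectors. -/

section LinearAlgebra

variable {n : ℕ}

/-- The Euclidean norm on `Fin n → ℝ`. -/
noncomputable def l2norm (x : Fin n → ℝ) : ℝ := ‖WithLp.toLp 2 x‖

theorem l2norm_nonneg (x : Fin n → ℝ) : 0 ≤ l2norm x := norm_nonneg _

theorem l2norm_sq (x : Fin n → ℝ) : l2norm x ^ 2 = ∑ i, x i ^ 2 := by
  simp [l2norm, EuclideanSpace.norm_sq_eq]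

theorem l2norm_zero : l2norm (0 : Fin n → ℝ) = 0 := by simp [l2norm]

theorem l2norm_add_le (x y : Fin n → ℝ) : l2norm (x + y) ≤ l2norm x + l2norm y := by
  simpa [l2norm] using norm_add_le (WithLp.toLp 2 x) (WithLp.toLp 2 y)

theorem l2norm_smul (a : ℝ) (x : Fin n → ℝ) : l2norm (a • x) = |a| * l2norm x := by
  simp [l2norm, norm_smul]

theorem l2norm_pos {x : Fin n → ℝ} (hx : x ≠ 0) : 0 < l2norm x := by
  simpa [l2norm] using hx

theorem abs_dotProduct_le (x y : Fin n → ℝ) : |x ⬝ᵥ y| ≤ l2norm x * l2norm y := by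
  have h := abs_real_inner_le_norm (WithLp.toLp 2 y) (WithLp.toLp 2 x)
  rw [EuclideanSpace.inner_toLp_toLp] at h
  simpa [l2norm, mul_comm] using h

theorem dotProduct_self_eq (x : Fin n → ℝ) : x ⬝ᵥ x = l2norm x ^ 2 := by
  rw [l2norm_sq]; simp [dotProduct, sq]

theorem abs_apply_le_l2norm (x : Fin n → ℝ) (i : Fin n) : |x i| ≤ l2norm x := by
  simpa [l2norm] using PiLp.norm_apply_le (WithLp.toLp 2 x) i

theorem l2norm_single (j : Fin n) (a : ℝ) : l2norm (Pi.single j a) = |a| := by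
  simp [l2norm]

theorem l2norm_le_of_abs_le {x y : Fin n → ℝ} (h : ∀ i, |x i| ≤ |y i|) :
    l2norm x ≤ l2norm y := by
  refine le_of_sq_le_sq ?_ (l2norm_nonneg y)
  rw [l2norm_sq, l2norm_sq]
  exact Finset.sum_le_sum fun i _ => sq_le_sq.2 (h i)

theorem l2norm_update_zero_le (x : Fin n → ℝ) (j : Fin n) :
    l2norm (Function.update x j 0) ≤ l2norm x := by
  refine l2norm_le_of_abs_le fun i => ?_
  by_cases h : i = j
  · subst h; simp
  · simp [h]

theorem IsUnitVector.l2norm_eq {x : Fin n → ℝ} (h : IsUnitVector x) : l2norm x = 1 := by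
  have h1 : l2norm x ^ 2 = 1 := by rw [l2norm_sq]; exact h
  have := l2norm_nonneg x
  nlinarith

/-- The matrix `W` with its `j`-th row and column replaced by zero. -/
def leaveOut (W : Matrix (Fin n) (Fin n) ℝ) (j : Fin n) : Matrix (Fin n) (Fin n) ℝ :=
  fun i l => if i = j ∨ l = j then 0 else W i l

/-- The power iterates of `leaveOut W j`, started at `v` with its `j`-th entry removed. -/
def leaveOutIterate (W : Matrix (Fin n) (Fin n) ℝ) (v : Fin n → ℝ) (j : Fin n) : ℕ → Fin n → ℝ
  | 0 => Function.update v j 0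
  | k + 1 => leaveOut W j *ᵥ leaveOutIterate W v j k

theorem leaveOutIterate_apply_self (W : Matrix (Fin n) (Fin n) ℝ) (v : Fin n → ℝ) (j : Fin n)
    (k : ℕ) : leaveOutIterate W v j k j = 0 := by
  cases k with
  | zero => simp [leaveOutIterate]
  | succ k => simp [leaveOutIterate, Matrix.mulVec, dotProduct, leaveOut]

/-- The iterate vanishes at `j`, so deleting column `j` changes nothing and only the deletion of row
`j` is felt. -/
theorem leaveOutIterate_succ (W : Matrix (Fin n) (Fin n) ℝ) (v : Fin n → ℝ) (j : Fin n) (k : ℕ) :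
    leaveOutIterate W v j (k + 1) = Function.update (W *ᵥ leaveOutIterate W v j k) j 0 := by
  ext i
  by_cases h : i = j
  · subst h; simpa using leaveOutIterate_apply_self W v i (k + 1)
  · rw [Function.update_of_ne h]
    simp only [leaveOutIterate, Matrix.mulVec, dotProduct]
    refine Finset.sum_congr rfl fun l _ => ?_
    by_cases hl : l = j
    · subst hl; simp [leaveOutIterate_apply_self]
    · simp [leaveOut, h, hl]

theorem mulVec_leaveOutIterate_eq (W : Matrix (Fin n) (Fin n) ℝ) (v : Fin n → ℝ) (j : Fin n)
    (k : ℕ) : W *ᵥ leaveOutIterate W v j k = leaveOutIterate W v j (k + 1) +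
      Pi.single j ((W *ᵥ leaveOutIterate W v j k) j) := by
  rw [leaveOutIterate_succ]
  ext i
  by_cases h : i = j
  · subst h; simp
  · simp [h]

theorem l2norm_leaveOutIterate_le {W : Matrix (Fin n) (Fin n) ℝ} {B : ℝ} (hB : 0 ≤ B)
    (hW : ∀ x, l2norm (W *ᵥ x) ≤ B * l2norm x) {v : Fin n → ℝ} (hv : l2norm v ≤ 1) (j : Fin n)
    (k : ℕ) : l2norm (leaveOutIterate W v j k) ≤ B ^ k := by
  induction k with
  | zero => simpa [leaveOutIterate] using (l2norm_update_zero_le v j).trans hv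
  | succ k ih =>
    rw [leaveOutIterate_succ, pow_succ']
    exact (l2norm_update_zero_le _ _).trans ((hW _).trans (by gcongr))

/-- Leave-one-out control of the entries of `W ^ k v`: no dependence on the other entries
of `v`. -/
theorem abs_pow_mulVec_apply_le {W : Matrix (Fin n) (Fin n) ℝ} {B c : ℝ} (hB : 0 ≤ B)
    (hc : 0 ≤ c) (hW : ∀ x, l2norm (W *ᵥ x) ≤ B * l2norm x) {v : Fin n → ℝ} (hv : l2norm v ≤ 1)
    (j : Fin n) {m : ℕ}
    (hloo : ∀ k < m, |(W *ᵥ leaveOutIterate W v j k) j| ≤ c * l2norm (leaveOutIterate W v j k))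
    {k : ℕ} (hk : k < m) :
    |((W ^ (k + 1)) *ᵥ v) j| ≤ B ^ (k + 1) * |v j| + (k + 1) * c * B ^ k := by
  -- The difference starts as `v j` times a basis vector. Each step multiplies it by `W` and adds
  -- the entry that the deleted row would have produced, at most `c * B ^ k`. At `k = 0` the
  -- truncated exponent `k - 1` is harmless because of the factor `k`.
  have key : ∀ k ≤ m, l2norm ((W ^ k) *ᵥ v - leaveOutIterate W v j k) ≤
      B ^ k * |v j| + k * c * B ^ (k - 1) := by
    intro k
    induction k with
    | zero =>
      intro _
      have h : (W ^ 0) *ᵥ v - leaveOutIterate W v j 0 = Pi.single j (v j) := by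
        ext i
        by_cases h : i = j
        · subst h; simp [leaveOutIterate]
        · simp [leaveOutIterate, h]
      rw [h, l2norm_single]; simp
    | succ k ih =>
      intro hk
      have ih := ih (by omega)
      have h : (W ^ (k + 1)) *ᵥ v - leaveOutIterate W v j (k + 1) =
          W *ᵥ ((W ^ k) *ᵥ v - leaveOutIterate W v j k) +
            Pi.single j ((W *ᵥ leaveOutIterate W v j k) j) := by
        rw [Matrix.mulVec_sub, pow_succ', ← Matrix.mulVec_mulVec,
          eq_sub_of_add_eq (mulVec_leaveOutIterate_eq W v j k).symm]
        abel
      rw [h]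
      have h1 : |(W *ᵥ leaveOutIterate W v j k) j| ≤ c * B ^ k :=
        (hloo k (by omega)).trans
          (mul_le_mul_of_nonneg_left (l2norm_leaveOutIterate_le hB hW hv j k) hc)
      have h2 : B * (k * c * B ^ (k - 1)) = k * c * B ^ k := by
        cases k with
        | zero => simp
        | succ k => simp only [Nat.add_sub_cancel]; ring
      calc _ ≤ B * l2norm ((W ^ k) *ᵥ v - leaveOutIterate W v j k) + c * B ^ k := by
              refine (l2norm_add_le _ _).trans (add_le_add (hW _) ?_)
              rwa [l2norm_single]
        _ ≤ B * (B ^ k * |v j| + k * c * B ^ (k - 1)) + c * B ^ k := by gcongr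
        _ = _ := by
              rw [mul_add, h2]; simp only [Nat.add_sub_cancel]; push_cast; ring
  have h1 := abs_apply_le_l2norm ((W ^ (k + 1)) *ᵥ v - leaveOutIterate W v j (k + 1)) j
  rw [Pi.sub_apply, leaveOutIterate_apply_self, sub_zero] at h1
  have h2 := key (k + 1) hk
  simp only [Nat.add_sub_cancel] at h2
  push_cast at h2
  linarith

theorem l2norm_pow_mulVec_le {W : Matrix (Fin n) (Fin n) ℝ} {B : ℝ} (hB : 0 ≤ B)
    (hW : ∀ x, l2norm (W *ᵥ x) ≤ B * l2norm x) (x : Fin n → ℝ) (k : ℕ) :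
    l2norm ((W ^ k) *ᵥ x) ≤ B ^ k * l2norm x := by
  induction k with
  | zero => simp
  | succ k ih =>
    rw [pow_succ', ← Matrix.mulVec_mulVec, pow_succ', mul_assoc]
    exact (hW _).trans (by gcongr)

/-- The truncated Neumann series of a fixed point of `x ↦ q • v + N x`. -/
theorem neumann_expansion {N : Matrix (Fin n) (Fin n) ℝ} {u v : Fin n → ℝ} {q : ℝ}
    (h : u = q • v + N *ᵥ u) (m : ℕ) :
    u = q • v + q • ∑ k ∈ Finset.range m, (N ^ (k + 1)) *ᵥ v + (N ^ (m + 1)) *ᵥ u := by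
  induction m with
  | zero => simpa using h
  | succ m ih =>
    have h2 : (N ^ (m + 1)) *ᵥ u = q • ((N ^ (m + 1)) *ᵥ v) + (N ^ (m + 1 + 1)) *ᵥ u := by
      conv_lhs => rw [h]
      rw [Matrix.mulVec_add, Matrix.mulVec_smul, Matrix.mulVec_mulVec, ← pow_succ]
    rw [Finset.sum_range_succ, smul_add]
    conv_lhs => rw [ih, h2]
    abel

theorem sum_geometric_le {r : ℝ} (h0 : 0 ≤ r) (m : ℕ) :
    (1 - r) * ∑ k ∈ Finset.range m, r ^ (k + 1) ≤ r := by
  have h : (1 - r) * ∑ k ∈ Finset.range m, r ^ (k + 1) = r - r ^ (m + 1) := by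
    induction m with
    | zero => simp
    | succ m ih => rw [Finset.sum_range_succ, mul_add, ih]; ring
  rw [h]
  have := pow_nonneg h0 (m + 1)
  linarith

theorem sum_arith_geometric_le {r : ℝ} (h0 : 0 ≤ r) (h1 : r ≤ 1) (m : ℕ) :
    (1 - r) ^ 2 * ∑ k ∈ Finset.range m, ((k : ℝ) + 1) * r ^ k ≤ 1 := by
  have h : (1 - r) ^ 2 * ∑ k ∈ Finset.range m, ((k : ℝ) + 1) * r ^ k =
      1 - ((m : ℝ) + 1) * r ^ m + m * r ^ (m + 1) := by
    induction m with
    | zero => simp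
    | succ m ih => rw [Finset.sum_range_succ, mul_add, ih]; push_cast; ring
  rw [h]
  have h2 : r ^ (m + 1) ≤ r ^ m := pow_le_pow_of_le_one h0 h1 (by omega)
  have h3 := pow_nonneg h0 m
  have h4 : (m : ℝ) * r ^ (m + 1) ≤ m * r ^ m := by gcongr
  linarith

/-- Entrywise perturbation of an eigenvector: if `t u = (λ ⟨v, u⟩) v + W u`, then `u` is
entrywise close to `± v`, without any dependence on the size of the largest entry of `v`. -/
theorem exists_sign_abs_sub_le {W : Matrix (Fin n) (Fin n) ℝ} {B c t p : ℝ} {u v : Fin n → ℝ}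
    {m : ℕ} (ht : 0 < t) (hB : 0 ≤ B) (hc : 0 ≤ c) (hBt : B / t ≤ 1 / 150)
    (hW : ∀ x, l2norm (W *ᵥ x) ≤ B * l2norm x) (hu : l2norm u = 1) (hv : l2norm v = 1)
    (heig : t • u = p • v + W *ᵥ u)
    (hloo : ∀ j, ∀ k < m,
      |(W *ᵥ leaveOutIterate W v j k) j| ≤ c * l2norm (leaveOutIterate W v j k)) :
    ∃ s : ℝ, (s = 1 ∨ s = -1) ∧ ∀ j, |u j - s * v j| ≤
      3 * (B / t) * |v j| + 1.03 * (c / t) + (B / t) ^ (m + 1) := by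
  set r := B / t with hr
  have hr0 : 0 ≤ r := by positivity
  set q := p / t with hq
  set N := t⁻¹ • W with hN
  have hNu : u = q • v + N *ᵥ u := by
    have h := congrArg (fun x => t⁻¹ • x) heig
    simp only [smul_smul, smul_add, inv_mul_cancel₀ ht.ne', one_smul] at h
    rw [hN, Matrix.smul_mulVec, hq, div_eq_inv_mul]
    exact h
  have hNop : ∀ x, l2norm (N *ᵥ x) ≤ r * l2norm x := by
    intro x
    rw [hN, Matrix.smul_mulVec, l2norm_smul, abs_of_pos (inv_pos.2 ht), hr, div_eq_inv_mul,
      mul_assoc]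
    exact mul_le_mul_of_nonneg_left (hW x) (inv_pos.2 ht).le
  have hqv : l2norm (q • v) = |q| := by rw [l2norm_smul, hv, mul_one]
  have hNu1 : l2norm (N *ᵥ u) ≤ r := by simpa [hu] using hNop u
  have hq1 : |q| ≤ 1 + r := by
    have h : q • v = u + (-1 : ℝ) • (N *ᵥ u) := by
      rw [neg_one_smul, ← sub_eq_add_neg]
      exact eq_sub_of_add_eq hNu.symm
    rw [← hqv, h]
    refine (l2norm_add_le _ _).trans ?_
    rw [l2norm_smul, hu]; simpa using hNu1
  have hq2 : 1 - r ≤ |q| := by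
    have h := l2norm_add_le (q • v) (N *ᵥ u)
    rw [← hNu, hu, hqv] at h
    linarith
  refine ⟨if 0 ≤ q then 1 else -1, by split_ifs <;> simp, fun j => ?_⟩
  set s : ℝ := if 0 ≤ q then 1 else -1 with hs
  -- Both `u` and `v` are unit vectors and `N *ᵥ u` has norm at most `r`, so `|q|` lies within `r`
  -- of `1`; `s` is the sign of `q`.
  have hqs : |q - s| ≤ r := by
    rw [hs]
    split_ifs with h
    · rw [abs_of_nonneg h] at hq1 hq2
      rw [abs_le]; constructor <;> linarith
    · rw [abs_of_neg (not_le.1 h)] at hq1 hq2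
      rw [abs_le]; constructor <;> linarith
  have hexp := congrFun (neumann_expansion hNu m) j
  simp only [Pi.add_apply, Pi.smul_apply, Finset.sum_apply, smul_eq_mul] at hexp
  have hterm : ∀ k ∈ Finset.range m, |((N ^ (k + 1)) *ᵥ v) j| ≤
      r ^ (k + 1) * |v j| + c / t * (((k : ℝ) + 1) * r ^ k) := by
    intro k hk
    have h := abs_pow_mulVec_apply_le hB hc hW hv.le j (hloo j) (Finset.mem_range.1 hk)
    rw [hN, smul_pow, Matrix.smul_mulVec, Pi.smul_apply, smul_eq_mul, abs_mul,
      abs_of_pos (by positivity)]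
    calc _ ≤ t⁻¹ ^ (k + 1) * (B ^ (k + 1) * |v j| + (k + 1) * c * B ^ k) := by gcongr
      _ = _ := by
        have hBr : B = r * t := (div_mul_cancel₀ B ht.ne').symm
        rw [hBr, mul_pow, mul_pow, inv_pow]
        field_simp
        ring
  have hsum : |∑ k ∈ Finset.range m, ((N ^ (k + 1)) *ᵥ v) j| ≤
      (∑ k ∈ Finset.range m, r ^ (k + 1)) * |v j| +
        c / t * ∑ k ∈ Finset.range m, ((k : ℝ) + 1) * r ^ k := by
    refine (Finset.abs_sum_le_sum_abs _ _).trans ((Finset.sum_le_sum hterm).trans ?_)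
    rw [Finset.sum_add_distrib, Finset.sum_mul, Finset.mul_sum]
  have hlast : |((N ^ (m + 1)) *ᵥ u) j| ≤ r ^ (m + 1) := by
    refine (abs_apply_le_l2norm _ j).trans ?_
    simpa [hu] using l2norm_pow_mulVec_le hr0 hNop u (m + 1)
  have hG := sum_geometric_le hr0 m
  have hT := sum_arith_geometric_le hr0 (hBt.trans (by norm_num)) m
  set G := ∑ k ∈ Finset.range m, r ^ (k + 1)
  set T := ∑ k ∈ Finset.range m, ((k : ℝ) + 1) * r ^ k
  -- With `r ≤ 1/150`, the factor `(1 + r)/(1 - r)` is below `2` and `(1 + r)/(1 - r)²` below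
  -- `1.03`. The `3` in the conclusion is this `2` plus `1` from `|q - s|`.
  have hG' : (1 + r) * G ≤ 2 * r := by
    have hG0 : 0 ≤ G := Finset.sum_nonneg fun k _ => pow_nonneg hr0 _
    nlinarith
  have hT' : (1 + r) * T ≤ 1.03 := by
    have hT0 : 0 ≤ T := Finset.sum_nonneg fun k _ => mul_nonneg (by positivity) (pow_nonneg hr0 _)
    have h : 1 + r ≤ 1.03 * (1 - r) ^ 2 := by nlinarith
    calc (1 + r) * T ≤ 1.03 * (1 - r) ^ 2 * T := by gcongr
      _ = 1.03 * ((1 - r) ^ 2 * T) := by ring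
      _ ≤ 1.03 * 1 := by gcongr
      _ = 1.03 := by norm_num
  have hct : 0 ≤ c / t := by positivity
  have hdiff : u j - s * v j = (q - s) * v j +
      (q * ∑ k ∈ Finset.range m, ((N ^ (k + 1)) *ᵥ v) j + ((N ^ (m + 1)) *ᵥ u) j) := by
    rw [hexp]; ring
  rw [hdiff]
  calc _ ≤ |q - s| * |v j| + (|q| * |∑ k ∈ Finset.range m, ((N ^ (k + 1)) *ᵥ v) j| +
          |((N ^ (m + 1)) *ᵥ u) j|) := by
        rw [← abs_mul, ← abs_mul]
        exact (abs_add_le _ _).trans (by gcongr; exact abs_add_le _ _)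
    _ ≤ r * |v j| + ((1 + r) * (G * |v j| + c / t * T) + r ^ (m + 1)) := by gcongr
    _ = r * |v j| + ((1 + r) * G) * |v j| + c / t * ((1 + r) * T) + r ^ (m + 1) := by ring
    _ ≤ r * |v j| + (2 * r) * |v j| + c / t * 1.03 + r ^ (m + 1) := by gcongr
    _ = _ := by ring

theorem isSymm_isHermitian {A : Matrix (Fin n) (Fin n) ℝ} (hA : A.IsSymm) : A.IsHermitian := by
  rw [Matrix.IsHermitian, Matrix.conjTranspose_eq_transpose_of_trivial]; exact hA

/-- Each eigenvalue of `t • 1 - A` is `t` minus an eigenvalue of `A`, so this matrix is positive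
semidefinite. Evaluated at the signal, this bounds the top eigenvalue from below. -/
theorem dotProduct_mulVec_le_of_eigenvalues_le {A : Matrix (Fin n) (Fin n) ℝ} (hA : A.IsSymm)
    {t : ℝ} (ht : ∀ s : ℝ, Module.End.HasEigenvalue (Matrix.toLin' A) s → s ≤ t)
    {x : Fin n → ℝ} (hx : l2norm x = 1) : x ⬝ᵥ A *ᵥ x ≤ t := by
  have hH : (t • (1 : Matrix (Fin n) (Fin n) ℝ) - A).IsHermitian :=
    isSymm_isHermitian (by
      rw [Matrix.IsSymm, Matrix.transpose_sub, Matrix.transpose_smul, Matrix.transpose_one, hA.eq])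
  have hP : (t • (1 : Matrix (Fin n) (Fin n) ℝ) - A).PosSemidef := by
    refine hH.posSemidef_iff_eigenvalues_nonneg.2 fun i => ?_
    have hv := hH.mulVec_eigenvectorBasis i
    set e := (hH.eigenvectorBasis i).ofLp with he
    have hne : e ≠ 0 := by
      intro h0
      have h1 := hH.eigenvectorBasis.orthonormal.1 i
      have h2 : hH.eigenvectorBasis i = 0 := by
        ext k; simpa [he] using congrFun h0 k
      rw [h2] at h1; simp at h1
    have h3 : A *ᵥ e = (t - hH.eigenvalues i) • e := by
      rw [Matrix.sub_mulVec, Matrix.smul_mulVec, Matrix.one_mulVec] at hv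
      rw [sub_smul, ← hv]; abel
    have h4 := ht _ (Module.End.hasEigenvalue_of_hasEigenvector
      (Module.End.hasEigenvector_iff.2 ⟨Module.End.mem_eigenspace_iff.2 (by
        rw [Matrix.toLin'_apply]; exact h3), hne⟩))
    simpa using h4
  have h := hP.dotProduct_mulVec_nonneg x
  rw [star_trivial, Matrix.sub_mulVec, Matrix.smul_mulVec, Matrix.one_mulVec, dotProduct_sub,
    dotProduct_smul, dotProduct_self_eq, hx] at h
  simpa using h

theorem exists_isTopEigenvector {A : Matrix (Fin n) (Fin n) ℝ} (hA : A.IsSymm) (hn : 0 < n) :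
    ∃ u, IsTopEigenvector A u := by
  have hH := isSymm_isHermitian hA
  have : Nonempty (Fin n) := ⟨⟨0, hn⟩⟩
  obtain ⟨i, -, hi⟩ := Finset.exists_max_image Finset.univ hH.eigenvalues Finset.univ_nonempty
  have hnorm : l2norm (hH.eigenvectorBasis i).ofLp = 1 := hH.eigenvectorBasis.orthonormal.1 i
  refine ⟨(hH.eigenvectorBasis i).ofLp, ?_, hH.eigenvalues i, ?_, fun s hs => ?_⟩
  · have h := l2norm_sq (hH.eigenvectorBasis i).ofLp
    rw [hnorm] at h
    simpa [IsUnitVector] using h.symm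
  · refine Module.End.hasEigenvector_iff.2 ⟨Module.End.mem_eigenspace_iff.2 ?_, ?_⟩
    · rw [Matrix.toLin'_apply]; exact hH.mulVec_eigenvectorBasis i
    · intro h0; rw [h0, l2norm_zero] at hnorm; norm_num at hnorm
  · have h1 := Module.End.hasEigenvalue_iff_mem_spectrum.1 hs
    rw [Matrix.spectrum_toLin', hH.spectrum_real_eq_range_eigenvalues] at h1
    obtain ⟨k, rfl⟩ := h1
    exact hi k (Finset.mem_univ k)

end LinearAlgebra

/-! ### Subgaussian tails for linear and bilinear forms in the noise. -/

section Probability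

theorem measure_lt_abs_le {Ω : Type*} [MeasurableSpace Ω] {P : Measure Ω} [IsProbabilityMeasure P]
    {X : Ω → ℝ} {v : ℝ≥0} (h : HasSubgaussianMGF X v P) {V s : ℝ} (hV : (v : ℝ) ≤ V)
    (hs : 0 ≤ s) : P {ω | √(2 * V * s) < |X ω|} ≤ ENNReal.ofReal (2 * Real.exp (-s)) := by
  have hmono : √(2 * v * s) ≤ √(2 * V * s) := Real.sqrt_le_sqrt (by gcongr)
  -- The Chernoff exponent divides by `v`. For `v = 0` the variable vanishes almost surely, and the
  -- strict inequality in the event keeps it null even when the threshold is `0`.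
  by_cases hv : v = 0
  · subst hv
    have h0 := h.ae_eq_zero_of_hasSubgaussianMGF_zero
    have h1 : P {ω | √(2 * V * s) < |X ω|} = 0 := by
      refine measure_mono_null (fun ω hω => ?_) (ae_iff.1 h0)
      intro h2
      simp only [Set.mem_ofPred_eq] at hω
      rw [h2] at hω
      simp only [Pi.zero_apply, abs_zero] at hω
      exact absurd (Real.sqrt_nonneg _) (not_le.2 hω)
    rw [h1]; exact zero_le
  · have hv0 : (0 : ℝ) < v := by positivity
    have hexp : -√(2 * v * s) ^ 2 / (2 * v) = -s := by
      rw [Real.sq_sqrt (by positivity)]; field_simp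
    have h1 := h.measure_ge_le (Real.sqrt_nonneg (2 * v * s))
    have h2 := h.neg.measure_ge_le (Real.sqrt_nonneg (2 * v * s))
    rw [hexp] at h1 h2
    have hsub : {ω | √(2 * V * s) < |X ω|} ⊆
        {ω | √(2 * v * s) ≤ X ω} ∪ {ω | √(2 * v * s) ≤ (-X) ω} := by
      intro ω hω
      rcases lt_abs.1 (lt_of_le_of_lt hmono hω) with h | h
      · exact Or.inl h.le
      · exact Or.inr h.le
    have h3 : P.real {ω | √(2 * V * s) < |X ω|} ≤ 2 * Real.exp (-s) := by
      refine (measureReal_mono hsub).trans ((measureReal_union_le _ _).trans ?_)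
      linarith
    rw [← ofReal_measureReal]
    exact ENNReal.ofReal_le_ofReal h3

theorem one_add_sq_div_two_le_cosh (x : ℝ) : 1 + x ^ 2 / 2 ≤ Real.cosh x := by
  have h1 : Real.cosh x = 1 + 2 * Real.sinh (x / 2) ^ 2 := by
    have h2 := Real.cosh_two_mul (x / 2)
    have h3 := Real.cosh_sq (x / 2)
    rw [show 2 * (x / 2) = x by ring] at h2
    linarith
  have h4 : (x / 2) ^ 2 ≤ Real.sinh (x / 2) ^ 2 := by
    rw [sq_le_sq, Real.abs_sinh]
    exact Real.self_le_sinh_iff.2 (abs_nonneg _)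
  rw [h1]; nlinarith

/-- Subgaussian variables have variance at most the variance proxy. -/
theorem variance_le_of_hasSubgaussianMGF {Ω : Type*} [MeasurableSpace Ω] {P : Measure Ω}
    [IsProbabilityMeasure P] {X : Ω → ℝ} {v : ℝ≥0} (h : HasSubgaussianMGF X v P) :
    Var[X; P] ≤ v := by
  have hX2 : Integrable (fun ω => X ω ^ 2) P := (h.memLp 2).integrable_sq
  have hvar : Var[X; P] ≤ ∫ ω, X ω ^ 2 ∂P := variance_le_expectation_sq h.aestronglyMeasurable
  refine hvar.trans ?_
  -- Adding the moment bounds at `t` and `-t` isolates the second moment through `cosh`. Dividing by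
  -- `t ^ 2 = 2 * y` and letting `y → 0` gives the sharp constant.
  have key : ∀ t : ℝ, 0 < t → t ^ 2 * ∫ ω, X ω ^ 2 ∂P ≤ 2 * (Real.exp (v * t ^ 2 / 2) - 1) := by
    intro t ht
    have hpt : ∀ ω, t ^ 2 * X ω ^ 2 + 2 ≤ Real.exp (t * X ω) + Real.exp (-t * X ω) := by
      intro ω
      have h1 := one_add_sq_div_two_le_cosh (t * X ω)
      rw [Real.cosh_eq] at h1
      rw [neg_mul]
      nlinarith
    have hi1 := h.integrable_exp_mul t
    have hi2 := h.integrable_exp_mul (-t)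
    have h1 := integral_mono (μ := P) ((hX2.const_mul (t ^ 2)).add (integrable_const (2 : ℝ)))
      (hi1.add hi2) hpt
    simp only [Pi.add_apply] at h1
    rw [integral_add (hX2.const_mul (t ^ 2)) (integrable_const _), integral_add hi1 hi2,
      integral_const_mul] at h1
    have h2 := h.mgf_le t
    have h3 := h.mgf_le (-t)
    simp only [mgf, neg_sq] at h2 h3
    simp at h1
    simp only [neg_mul] at h3
    linarith
  have hlim : Filter.Tendsto (fun y : ℝ => v * Real.exp (v * y)) (nhdsWithin 0 (Set.Ioi 0))
      (nhds v) := by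
    have hc : Continuous fun y : ℝ => v * Real.exp (v * y) := by fun_prop
    have := hc.tendsto 0
    simp only [mul_zero, Real.exp_zero, mul_one] at this
    exact this.mono_left nhdsWithin_le_nhds
  refine ge_of_tendsto hlim ?_
  filter_upwards [self_mem_nhdsWithin] with y hy
  have hy : 0 < y := hy
  have h1 := key (√(2 * y)) (by positivity)
  rw [Real.sq_sqrt (by positivity)] at h1
  have h2 : (v : ℝ) * (2 * y) / 2 = v * y := by ring
  rw [h2] at h1
  have h3 : Real.exp (v * y) - 1 ≤ v * y * Real.exp (v * y) := by
    have h4 := Real.add_one_le_exp (-(v * y))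
    have h5 : Real.exp (v * y) * Real.exp (-(v * y)) = 1 := by rw [← Real.exp_add]; simp
    nlinarith [Real.exp_pos (v * y)]
  have h6 : y * ∫ ω, X ω ^ 2 ∂P ≤ y * (v * Real.exp (v * y)) := by linarith
  exact le_of_mul_le_mul_left h6 hy

variable {n : ℕ}

/-- Entries `(i, j)` and `(j, i)` are paired, because independence is available only on and above
the diagonal. -/
theorem sum_sum_eq_sum_upper (f : Fin n → Fin n → ℝ) :
    ∑ i, ∑ j, f i j = ∑ p : {p : Fin n × Fin n // p.1 ≤ p.2},
      if p.1.1 = p.1.2 then f p.1.1 p.1.1 else f p.1.1 p.1.2 + f p.1.2 p.1.1 := by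
  have h1 : ∑ p : {p : Fin n × Fin n // p.1 ≤ p.2},
      (if p.1.1 = p.1.2 then f p.1.1 p.1.1 else f p.1.1 p.1.2 + f p.1.2 p.1.1) =
      ∑ i, ∑ j, if i ≤ j then (if i = j then f i i else f i j + f j i) else 0 := by
    rw [← Fintype.sum_prod_type', ← Finset.sum_filter]
    exact (Finset.sum_subtype (p := fun p : Fin n × Fin n => p.1 ≤ p.2)
      (Finset.univ.filter fun p : Fin n × Fin n => p.1 ≤ p.2) (by simp)
      (fun p => if p.1 = p.2 then f p.1 p.1 else f p.1 p.2 + f p.2 p.1)).symm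
  have h2 : ∑ i, ∑ j, f i j = ∑ i, ∑ j, (if i ≤ j then f i j else 0) +
      ∑ i, ∑ j, (if i < j then f j i else 0) := by
    rw [Finset.sum_comm (f := fun i j => if i < j then f j i else 0), ← Finset.sum_add_distrib]
    refine Finset.sum_congr rfl fun i _ => ?_
    rw [← Finset.sum_add_distrib]
    refine Finset.sum_congr rfl fun j _ => ?_
    by_cases h : i ≤ j
    · simp [h, not_lt.2 h]
    · simp [h, not_le.1 h]
  rw [h1, h2, ← Finset.sum_add_distrib]
  refine Finset.sum_congr rfl fun i _ => ?_
  rw [← Finset.sum_add_distrib]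
  refine Finset.sum_congr rfl fun j _ => ?_
  rcases lt_trichotomy i j with h | h | h
  · simp [h, h.le, h.ne]
  · subst h; simp
  · simp [not_le.2 h, not_lt.2 h.le]

variable {Ω : Type*} [MeasurableSpace Ω] {P : Measure Ω} {σ : ℝ}
  {ν : ℝ≥0} {W : Ω → Matrix (Fin n) (Fin n) ℝ}

/-- By symmetry an off-diagonal noise entry carries the coefficient `M i j + M j i`, whose square is
at most `2 (M i j ^ 2 + M j i ^ 2)`; hence the factor `2`. -/
theorem IsNoise.exists_hasSubgaussianMGF_sum (hW : IsNoise P σ ν W)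
    (M : Fin n → Fin n → ℝ) : ∃ v : ℝ≥0, (v : ℝ) ≤ 2 * ν * ∑ i, ∑ j, M i j ^ 2 ∧
      HasSubgaussianMGF (fun ω => ∑ i, ∑ j, M i j * W ω i j) v P := by
  let a : {p : Fin n × Fin n // p.1 ≤ p.2} → ℝ := fun p =>
    if p.1.1 = p.1.2 then M p.1.1 p.1.1 else M p.1.1 p.1.2 + M p.1.2 p.1.1
  have hind : iIndepFun (fun p ω => a p * W ω p.1.1 p.1.2) P :=
    hW.indep.comp (fun p x => a p * x) (fun p => measurable_const_mul (a p))
  have hsum := HasSubgaussianMGF.sum_of_iIndepFun hind (s := Finset.univ)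
    (c := fun p => ⟨a p ^ 2, sq_nonneg _⟩ * ν)
    (fun p _ => (hW.subgaussian p.1.1 p.1.2).const_mul (a p))
  refine ⟨_, ?_, hsum.congr (Filter.Eventually.of_forall fun ω => ?_)⟩
  · rw [sum_sum_eq_sum_upper, Finset.mul_sum, NNReal.coe_sum]
    refine Finset.sum_le_sum fun p _ => ?_
    have hν : (0 : ℝ) ≤ ν := ν.2
    change a p ^ 2 * (ν : ℝ) ≤ _
    by_cases h : p.1.1 = p.1.2
    · simp only [a, h, if_true]
      nlinarith [mul_nonneg hν (sq_nonneg (M p.1.2 p.1.2))]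
    · simp only [a, h, if_false]
      nlinarith [mul_nonneg hν (sq_nonneg (M p.1.1 p.1.2 - M p.1.2 p.1.1))]
  · change _ = ∑ i, ∑ j, M i j * W ω i j
    rw [sum_sum_eq_sum_upper]
    refine Finset.sum_congr rfl fun p _ => ?_
    by_cases h : p.1.1 = p.1.2
    · simp [a, h]
    · have hs : W ω p.1.2 p.1.1 = W ω p.1.1 p.1.2 := (hW.symm ω).apply _ _
      simp only [a, h, if_false, hs]; ring

variable [IsProbabilityMeasure P]

/-- Tail bound for a bilinear form in the noise. -/
theorem IsNoise.measure_lt_abs_bilin_le (hW : IsNoise P σ ν W) (x y : Fin n → ℝ) {s : ℝ}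
    (hs : 0 ≤ s) : P {ω | √(4 * ν * s) * (l2norm x * l2norm y) < |x ⬝ᵥ W ω *ᵥ y|} ≤
      ENNReal.ofReal (2 * Real.exp (-s)) := by
  obtain ⟨v, hv, hX⟩ := hW.exists_hasSubgaussianMGF_sum fun i j => x i * y j
  have hF : ∑ i, ∑ j, (x i * y j) ^ 2 = (l2norm x * l2norm y) ^ 2 := by
    rw [mul_pow, l2norm_sq, l2norm_sq, Finset.sum_mul_sum]
    simp only [mul_pow]
  rw [hF] at hv
  have h := measure_lt_abs_le hX hv hs
  have h0 : 0 ≤ l2norm x * l2norm y := mul_nonneg (l2norm_nonneg x) (l2norm_nonneg y)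
  have h1 : √(2 * (2 * ν * (l2norm x * l2norm y) ^ 2) * s) =
      √(4 * ν * s) * (l2norm x * l2norm y) := by
    rw [show 2 * (2 * (ν : ℝ) * (l2norm x * l2norm y) ^ 2) * s =
      (4 * ν * s) * (l2norm x * l2norm y) ^ 2 by ring, Real.sqrt_mul (by positivity),
      Real.sqrt_sq h0]
  have h2 : ∀ ω, ∑ i, ∑ j, x i * y j * W ω i j = x ⬝ᵥ W ω *ᵥ y := by
    intro ω
    simp only [dotProduct, Matrix.mulVec, Finset.mul_sum]
    refine Finset.sum_congr rfl fun i _ => Finset.sum_congr rfl fun j _ => by ring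
  simpa only [h1, h2] using h

theorem IsNoise.measure_lt_abs_mulVec_apply_le (hW : IsNoise P σ ν W) (j : Fin n)
    (y : Fin n → ℝ) {s : ℝ} (hs : 0 ≤ s) :
    P {ω | √(4 * ν * s) * l2norm y < |(W ω *ᵥ y) j|} ≤ ENNReal.ofReal (2 * Real.exp (-s)) := by
  have h := hW.measure_lt_abs_bilin_le (Pi.single j 1) y hs
  simpa [l2norm_single] using h

/-! ### Independence of a noise row from its leave-one-out iterates. -/

/-- The symmetric matrix with the given entries on and above the diagonal. -/
def symmOfUpper (g : {p : Fin n × Fin n // p.1 ≤ p.2} → ℝ) : Matrix (Fin n) (Fin n) ℝ :=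
  fun i l => g ⟨(min i l, max i l), min_le_max⟩

/-- Extension of a finite family of upper-triangular entries by zero. -/
def extendZero (S : Finset {p : Fin n × Fin n // p.1 ≤ p.2}) (f : S → ℝ)
    (p : {p : Fin n × Fin n // p.1 ≤ p.2}) : ℝ :=
  if h : p ∈ S then f ⟨p, h⟩ else 0

theorem measurable_symmOfUpper_extendZero (S : Finset {p : Fin n × Fin n // p.1 ≤ p.2})
    (i l : Fin n) : Measurable fun f : S → ℝ => symmOfUpper (extendZero S f) i l := by
  unfold symmOfUpper extendZero
  by_cases h : (⟨(min i l, max i l), min_le_max⟩ : {p : Fin n × Fin n // p.1 ≤ p.2}) ∈ S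
  · simp only [h, dif_pos]; exact measurable_pi_apply _
  · simp only [h, dif_neg, not_false_eq_true]; exact measurable_const

theorem symmOfUpper_extendZero_apply {A : Matrix (Fin n) (Fin n) ℝ} (hA : A.IsSymm)
    (S : Finset {p : Fin n × Fin n // p.1 ≤ p.2}) (i l : Fin n)
    (h : (⟨(min i l, max i l), min_le_max⟩ : {p : Fin n × Fin n // p.1 ≤ p.2}) ∈ S) :
    symmOfUpper (extendZero S fun p => A p.1.1.1 p.1.1.2) i l = A i l := by
  simp only [symmOfUpper, extendZero, h, dif_pos]
  rcases le_total i l with h | h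
  · simp [h]
  · simpa [h] using hA.apply i l

/-- The iterates see the matrix only through `leaveOut`, so they are functions of the noise outside
row and column `j`. -/
theorem leaveOutIterate_congr {A A' : Matrix (Fin n) (Fin n) ℝ} {j : Fin n}
    (h : leaveOut A j = leaveOut A' j) (v : Fin n → ℝ) (k : ℕ) :
    leaveOutIterate A v j k = leaveOutIterate A' v j k := by
  induction k with
  | zero => rfl
  | succ k ih => rw [leaveOutIterate, leaveOutIterate, h, ih]

theorem measurable_leaveOutIterate {E : Type*} [MeasurableSpace E]
    {A : E → Matrix (Fin n) (Fin n) ℝ} (hA : ∀ i l, Measurable fun e => A e i l)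
    (v : Fin n → ℝ) (j : Fin n) (k : ℕ) (i : Fin n) :
    Measurable fun e => leaveOutIterate (A e) v j k i := by
  induction k generalizing i with
  | zero => exact measurable_const
  | succ k ih =>
    simp only [leaveOutIterate, Matrix.mulVec, dotProduct]
    refine Finset.measurable_sum _ fun l _ => Measurable.mul ?_ (ih l)
    unfold leaveOut
    by_cases h : i = j ∨ l = j
    · simp only [h, if_true]; exact measurable_const
    · simp only [h, if_false]; exact hA i l

theorem measurable_l2norm : Measurable (l2norm : (Fin n → ℝ) → ℝ) := by
  have h : (l2norm : (Fin n → ℝ) → ℝ) = fun x => √(∑ i, x i ^ 2) := by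
    ext x; rw [← l2norm_sq, Real.sqrt_sq (l2norm_nonneg x)]
  rw [h]; fun_prop

/-- The `j`-th row of the noise is independent of the leave-one-out iterates at `j`. -/
theorem IsNoise.measure_lt_abs_leaveOutIterate_le (hW : IsNoise P σ ν W) (v : Fin n → ℝ)
    (j : Fin n) (k : ℕ) {s : ℝ} (hs : 0 ≤ s) :
    P {ω | √(4 * ν * s) * l2norm (leaveOutIterate (W ω) v j k) <
        |(W ω *ᵥ leaveOutIterate (W ω) v j k) j|} ≤ ENNReal.ofReal (2 * Real.exp (-s)) := by
  -- `S` collects the upper-triangular positions that meet index `j`, which determine row `j`; `T`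
  -- collects the others, which determine the iterates.
  let S : Finset {p : Fin n × Fin n // p.1 ≤ p.2} :=
    Finset.univ.filter fun p => p.1.1 = j ∨ p.1.2 = j
  let T : Finset {p : Fin n × Fin n // p.1 ≤ p.2} :=
    Finset.univ.filter fun p => ¬ (p.1.1 = j ∨ p.1.2 = j)
  have hST : Disjoint S T := Finset.disjoint_filter_filter_not _ _ _
  let F : Ω → S → ℝ := fun ω p => W ω p.1.1.1 p.1.1.2
  let G : Ω → T → ℝ := fun ω p => W ω p.1.1.1 p.1.1.2
  have hF : Measurable F := measurable_pi_lambda _ fun p => hW.measurable _ _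
  have hG : Measurable G := measurable_pi_lambda _ fun p => hW.measurable _ _
  have hind : IndepFun F G P :=
    hW.indep.indepFun_finset S T hST fun p => hW.measurable _ _
  let b : (T → ℝ) → Fin n → ℝ := fun g => leaveOutIterate (symmOfUpper (extendZero T g)) v j k
  let r : (S → ℝ) → Fin n → ℝ := fun f => symmOfUpper (extendZero S f) j
  have hb : ∀ i, Measurable fun g => b g i := fun i =>
    measurable_leaveOutIterate (measurable_symmOfUpper_extendZero T) v j k i
  have hbl : Measurable fun g => l2norm (b g) := measurable_l2norm.comp (measurable_pi_lambda _ hb)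
  have hr : ∀ l, Measurable fun f => r f l := fun l => measurable_symmOfUpper_extendZero S j l
  have hrF : ∀ ω, r (F ω) = W ω j := by
    intro ω
    ext l
    refine symmOfUpper_extendZero_apply (hW.symm ω) S j l ?_
    rcases le_total j l with h | h
    · simp [S, h]
    · simp [S, h]
  have hbG : ∀ ω, b (G ω) = leaveOutIterate (W ω) v j k := by
    intro ω
    refine leaveOutIterate_congr ?_ v k
    ext i l
    unfold leaveOut
    by_cases h : i = j ∨ l = j
    · simp [h]
    · simp only [h, if_false]
      refine symmOfUpper_extendZero_apply (hW.symm ω) T i l ?_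
      push Not at h
      rcases le_total i l with h1 | h1
      · simp [T, h1, h.1, h.2]
      · simp [T, h1, h.1, h.2]
  let E : Set ((S → ℝ) × (T → ℝ)) := {q | √(4 * ν * s) * l2norm (b q.2) < |r q.1 ⬝ᵥ b q.2|}
  have hE : MeasurableSet E := by
    refine measurableSet_lt ((hbl.comp measurable_snd).const_mul _) ?_
    refine Measurable.abs ?_
    unfold dotProduct
    exact Finset.measurable_sum _ fun l _ =>
      ((hr l).comp measurable_fst).mul ((hb l).comp measurable_snd)
  have hEv : {ω | √(4 * ν * s) * l2norm (leaveOutIterate (W ω) v j k) <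
      |(W ω *ᵥ leaveOutIterate (W ω) v j k) j|} = (fun ω => (F ω, G ω)) ⁻¹' E := by
    ext ω
    simp only [E, Set.mem_preimage, Set.mem_ofPred_eq, hrF, hbG]
    rfl
  have hPG : IsProbabilityMeasure (P.map G) := Measure.isProbabilityMeasure_map hG.aemeasurable
  have hPF : IsProbabilityMeasure (P.map F) := Measure.isProbabilityMeasure_map hF.aemeasurable
  rw [hEv, ← Measure.map_apply (hF.prodMk hG) hE,
    (indepFun_iff_map_prod_eq_prod_map_map hF.aemeasurable hG.aemeasurable).1 hind,
    Measure.prod_apply_symm hE]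
  -- Once the entries in `T` are frozen, the iterate is a deterministic vector and the row tail
  -- bound applies; Fubini then averages over `g`.
  have hsec : ∀ g, P.map F ((fun f => (f, g)) ⁻¹' E) ≤ ENNReal.ofReal (2 * Real.exp (-s)) := by
    intro g
    rw [Measure.map_apply hF (measurable_prodMk_right hE)]
    refine le_trans (measure_mono fun ω hω => ?_) (hW.measure_lt_abs_mulVec_apply_le j (b g) hs)
    simp only [E, Set.mem_preimage, Set.mem_ofPred_eq, hrF] at hω
    exact hω
  refine (lintegral_mono hsec).trans ?_
  simp

end Probability

/-! ### Operator norm from an integer grid. -/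

section OperatorNorm

variable {n : ℕ}

/-- Rounding `2√n · x` entrywise costs at most `1/(4√n)` per entry of `x`, that is `1/4` in
Euclidean norm. -/
theorem exists_int_approx {x : Fin n → ℝ} (hx : l2norm x = 1) {N : ℕ} (hN : 2 * √n + 1 / 2 ≤ N) :
    ∃ (z : Fin n → ℤ) (d : Fin n → ℝ), (∀ i, |z i| ≤ N) ∧
      x = (2 * √n)⁻¹ • (fun i => (z i : ℝ)) + d ∧ l2norm d ≤ 1 / 4 := by
  have hn : 0 < n := by
    rcases Nat.eq_zero_or_pos n with h | h
    · subst h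
      have h0 : x = 0 := Subsingleton.elim _ _
      rw [h0, l2norm_zero] at hx; norm_num at hx
    · exact h
  have hn' : (0 : ℝ) < n := by exact_mod_cast hn
  have hR : 0 < 2 * √(n : ℝ) := by positivity
  set R := 2 * √(n : ℝ) with hRdef
  have hR2 : R ^ 2 = 4 * n := by rw [hRdef, mul_pow, Real.sq_sqrt hn'.le]; norm_num
  refine ⟨fun i => round (R * x i), x - R⁻¹ • fun i => ((round (R * x i) : ℤ) : ℝ), fun i => ?_,
    by simp, ?_⟩
  · have h1 := abs_sub_round (R * x i)
    have h2 : |R * x i| ≤ R := by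
      rw [abs_mul, abs_of_pos hR]
      have := abs_apply_le_l2norm x i
      rw [hx] at this
      nlinarith
    have h3 : |((round (R * x i) : ℤ) : ℝ)| ≤ N := by
      rw [abs_le] at *
      constructor <;> linarith
    exact_mod_cast h3
  · refine le_of_sq_le_sq ?_ (by norm_num)
    rw [l2norm_sq]
    have h4 : ∀ i ∈ Finset.univ, (x - R⁻¹ • fun i => ((round (R * x i) : ℤ) : ℝ)) i ^ 2 ≤
        (1 / (16 * n) : ℝ) := by
      intro i _
      have h1 := sq_le_sq.2 ((abs_sub_round (R * x i)).trans (le_abs_self (1 / 2 : ℝ)))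
      have h5 : (x - R⁻¹ • fun i => ((round (R * x i) : ℤ) : ℝ)) i =
          R⁻¹ * (R * x i - round (R * x i)) := by
        simp only [Pi.sub_apply, Pi.smul_apply, smul_eq_mul]; field_simp
      rw [h5, mul_pow, inv_pow, hR2, ← div_eq_inv_mul, div_le_div_iff₀ (by positivity)
        (by positivity)]
      nlinarith
    refine (Finset.sum_le_sum h4).trans (le_of_eq ?_)
    simp only [Finset.sum_const, Finset.card_univ, Fintype.card_fin, nsmul_eq_mul]
    field_simp; norm_num

/-- A bound on the bilinear form of `A` at bounded integer vectors yields a bound on its operator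
norm. -/
theorem l2norm_mulVec_le_of_int {A : Matrix (Fin n) (Fin n) ℝ} {N : ℕ} {T : ℝ}
    (hN : 2 * √n + 1 / 2 ≤ N) (hT : 0 ≤ T)
    (h : ∀ x y : Fin n → ℤ, (∀ i, |x i| ≤ N) → (∀ i, |y i| ≤ N) →
      |(fun i => (x i : ℝ)) ⬝ᵥ A *ᵥ (fun i => (y i : ℝ))| ≤
        T * (l2norm (fun i => (x i : ℝ)) * l2norm (fun i => (y i : ℝ)))) (x : Fin n → ℝ) :
    l2norm (A *ᵥ x) ≤ 25 / 7 * T * l2norm x := by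
  set L := Matrix.toEuclideanCLM (𝕜 := ℝ) A with hL
  have hLx : ∀ x : Fin n → ℝ, ‖L (WithLp.toLp 2 x)‖ = l2norm (A *ᵥ x) := fun x => by
    rw [hL, Matrix.toEuclideanCLM_toLp]; rfl
  set M := ‖L‖ with hM
  have hM0 : 0 ≤ M := norm_nonneg _
  have hop : ∀ x, l2norm (A *ᵥ x) ≤ M * l2norm x := fun x => by
    rw [← hLx]; exact L.le_opNorm _
  -- Grid approximants have norm at most `5/4`, giving `(5/4)² T`; the two remainders cost `5/4 ·
  -- 1/4 · M` and `1/4 · M`. Since `9/16 < 1`, the resulting inequality for `M` solves to `M ≤ 25/7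
  -- T`.
  have hbil : ∀ x y, l2norm x = 1 → l2norm y = 1 → |x ⬝ᵥ A *ᵥ y| ≤ 25 / 16 * T + 9 / 16 * M := by
    intro x y hx hy
    obtain ⟨z, d, hz, hxd, hd⟩ := exists_int_approx hx hN
    obtain ⟨w, e, hw, hye, he⟩ := exists_int_approx hy hN
    set a := (2 * √(n : ℝ))⁻¹ with ha
    set z' : Fin n → ℝ := fun i => (z i : ℝ)
    set w' : Fin n → ℝ := fun i => (w i : ℝ)
    have ha0 : 0 ≤ a := by positivity
    have hn1 : ∀ (x z d : Fin n → ℝ), l2norm x = 1 → x = a • z + d → l2norm d ≤ 1 / 4 →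
        l2norm (a • z) ≤ 5 / 4 := by
      intro x z d hx hxd hd
      have h1 : a • z = x + (-1 : ℝ) • d := by rw [hxd]; simp
      rw [h1]
      refine (l2norm_add_le _ _).trans ?_
      rw [l2norm_smul, hx]; simp; linarith
    have hz1 := hn1 x z' d hx hxd hd
    have hw1 := hn1 y w' e hy hye he
    have h1 : |(a • z') ⬝ᵥ A *ᵥ (a • w')| ≤ T * (5 / 4 * (5 / 4)) := by
      have h2 : |(a • z') ⬝ᵥ A *ᵥ (a • w')| = a * a * |z' ⬝ᵥ A *ᵥ w'| := by
        rw [Matrix.mulVec_smul, smul_dotProduct, dotProduct_smul, smul_eq_mul, smul_eq_mul,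
          abs_mul, abs_mul, abs_of_nonneg ha0]; ring
      have h3 : a * a * (T * (l2norm z' * l2norm w')) = T * (l2norm (a • z') * l2norm (a • w')) := by
        rw [l2norm_smul, l2norm_smul, abs_of_nonneg ha0]; ring
      rw [h2]
      refine (mul_le_mul_of_nonneg_left (h z w hz hw) (by positivity)).trans ?_
      rw [h3]
      have := l2norm_nonneg (a • w')
      gcongr
    have h2 : |(a • z') ⬝ᵥ A *ᵥ e| ≤ 5 / 4 * (M * (1 / 4)) := by
      refine (abs_dotProduct_le _ _).trans ?_
      have h3 := hop e
      have h4 := l2norm_nonneg (A *ᵥ e)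
      have h5 : M * l2norm e ≤ M * (1 / 4) := by gcongr
      exact mul_le_mul hz1 (h3.trans h5) h4 (by norm_num)
    have h3 : |d ⬝ᵥ A *ᵥ y| ≤ 1 / 4 * M := by
      refine (abs_dotProduct_le _ _).trans ?_
      have h3 := hop y
      rw [hy, mul_one] at h3
      exact mul_le_mul hd h3 (l2norm_nonneg _) (by norm_num)
    have h4 : x ⬝ᵥ A *ᵥ y = (a • z') ⬝ᵥ A *ᵥ (a • w') + (a • z') ⬝ᵥ A *ᵥ e + d ⬝ᵥ A *ᵥ y := by
      conv_lhs => rw [hxd, add_dotProduct]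
      congr 1
      rw [← dotProduct_add, ← Matrix.mulVec_add, ← hye]
    rw [h4]
    refine (abs_add_le _ _).trans ((add_le_add (abs_add_le _ _) le_rfl).trans ?_)
    linarith
  have hunit : ∀ y, l2norm y = 1 → l2norm (A *ᵥ y) ≤ 25 / 16 * T + 9 / 16 * M := by
    intro y hy
    by_cases h0 : A *ᵥ y = 0
    · rw [h0, l2norm_zero]; positivity
    · have hp := l2norm_pos h0
      have h1 := hbil ((l2norm (A *ᵥ y))⁻¹ • (A *ᵥ y)) y
        (by rw [l2norm_smul, abs_of_pos (inv_pos.2 hp), inv_mul_cancel₀ hp.ne']) hy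
      rw [smul_dotProduct, dotProduct_self_eq, smul_eq_mul, abs_of_nonneg (by positivity), sq,
        ← mul_assoc, inv_mul_cancel₀ hp.ne', one_mul] at h1
      exact h1
  have hMle : M ≤ 25 / 16 * T + 9 / 16 * M := by
    refine L.opNorm_le_bound (by positivity) fun y => ?_
    by_cases h0 : y.ofLp = 0
    · have h1 : y = 0 := by ext i; exact congrFun h0 i
      rw [h1]; simp
    · have hp := l2norm_pos h0
      have h1 := hunit ((l2norm y.ofLp)⁻¹ • y.ofLp)
        (by rw [l2norm_smul, abs_of_pos (inv_pos.2 hp), inv_mul_cancel₀ hp.ne'])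
      rw [Matrix.mulVec_smul, l2norm_smul, abs_of_pos (inv_pos.2 hp), ← div_eq_inv_mul,
        div_le_iff₀ hp] at h1
      have h2 := hLx y.ofLp
      rw [WithLp.toLp_ofLp] at h2
      rw [h2]; exact h1
  refine (hop x).trans (mul_le_mul_of_nonneg_right ?_ (l2norm_nonneg x))
  linarith

end OperatorNorm

/-! ### Number and size of the candidate thresholds. -/

section Levels

theorem exists_finset_levels {n : ℕ} (hn : 2 ≤ n) (hlog : 1 ≤ Real.log (Real.log n)) :
    ∃ T : Finset ℝ, levels n ⊆ T ∧ T.card ≤ n + 2 := by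
  classical
  refine ⟨insert (Real.log n ^ (-levelExponent n / 2)) ((Finset.range ⌈levelExponent n⌉₊).image
    fun k : ℕ => Real.log n ^ (-(k : ℝ) / 2)), ?_, ?_⟩
  · rintro a (⟨k, -, hk, rfl⟩ | rfl)
    · simp only [Finset.coe_insert, Finset.coe_image]
      exact Or.inr ⟨k, by simpa using hk, rfl⟩
    · simp
  · refine (Finset.card_insert_le _ _).trans (Nat.succ_le_succ (Finset.card_image_le.trans ?_))
    rw [Finset.card_range]
    refine Nat.ceil_le.2 ?_
    have hn' : (2 : ℝ) ≤ n := by exact_mod_cast hn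
    have h1 : Real.log (2 * n) ≤ n + 1 := by
      rw [Real.log_mul (by norm_num) (by positivity)]
      have h2 := Real.log_le_sub_one_of_pos (show (0 : ℝ) < 2 by norm_num)
      have h3 := Real.log_le_sub_one_of_pos (show (0 : ℝ) < n by positivity)
      linarith
    push_cast
    exact (div_le_self (Real.log_nonneg (by linarith)) hlog).trans h1

/-- The exponent `L` is chosen so that the last level `(log n)^(-L/2)` equals `1/√(2n)`; the other
levels have larger exponents. -/
theorem one_div_sqrt_le_of_mem_levels {n : ℕ} (hn : 2 ≤ n) (hlog : 1 ≤ Real.log (Real.log n))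
    {a : ℝ} (ha : a ∈ levels n) : 1 / √(2 * n) ≤ a := by
  have hn' : (2 : ℝ) ≤ n := by exact_mod_cast hn
  have hl0 : 0 < Real.log n := Real.log_pos (by linarith)
  have hl1 : 1 ≤ Real.log n := by
    by_contra h
    have := Real.log_nonpos hl0.le (not_le.1 h).le
    linarith
  have hlast : Real.log n ^ (-levelExponent n / 2) = 1 / √(2 * n) := by
    rw [Real.rpow_def_of_pos hl0, Real.sqrt_eq_rpow, Real.rpow_def_of_pos (by positivity),
      one_div, ← Real.exp_neg]
    congr 1
    unfold levelExponent
    field_simp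
  rcases ha with ⟨k, -, hk, rfl⟩ | rfl
  · rw [← hlast]
    refine Real.rpow_le_rpow_of_exponent_le hl1 ?_
    have := (Nat.lt_ceil.1 hk).le
    linarith
  · exact hlast.ge

end Levels

/-! ### The high-probability event on the noise. -/

section GoodEvent

variable {n : ℕ}

/-- The signs of the large entries of `v`, and `0` elsewhere. -/
noncomputable def selectedSigns (v : Fin n → ℝ) (a : ℝ) (k : Fin n) : ℝ :=
  if k ∈ largeEntries v a then Real.sign (v k) else 0

theorem l2norm_selectedSigns_le (v : Fin n → ℝ) (a : ℝ) :
    l2norm (selectedSigns v a) ≤ √((largeEntries v a).card : ℝ) := by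
  refine Real.le_sqrt_of_sq_le ?_
  rw [l2norm_sq]
  have h : ∀ k ∈ Finset.univ, selectedSigns v a k ^ 2 ≤ if k ∈ largeEntries v a then 1 else 0 := by
    intro k _
    unfold selectedSigns
    split_ifs
    · rcases Real.sign_apply_eq (v k) with h | h | h <;> rw [h] <;> norm_num
    · norm_num
  refine (Finset.sum_le_sum h).trans (le_of_eq ?_)
  simp

/-- Control of the noise matrix `W` relative to the signal vector `v`: its operator norm, its rows
against the leave-one-out iterates, and its sums over the level sets of `v`. -/
structure IsControlled (W : Matrix (Fin n) (Fin n) ℝ) (v : Fin n → ℝ) (B c : ℝ) (m : ℕ) :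
    Prop where
  opNorm : ∀ x, l2norm (W *ᵥ x) ≤ B * l2norm x
  leaveOut : ∀ j, ∀ k < m,
    |(W *ᵥ leaveOutIterate W v j k) j| ≤ c * l2norm (leaveOutIterate W v j k)
  row : ∀ a ∈ levels n, ∀ j,
    |(W *ᵥ selectedSigns v a) j| ≤ c * √((largeEntries v a).card : ℝ)
  quad : ∀ a ∈ levels n,
    |selectedSigns v a ⬝ᵥ W *ᵥ selectedSigns v a| ≤ c * ((largeEntries v a).card : ℝ)

theorem leaveOutIterate_neg (W : Matrix (Fin n) (Fin n) ℝ) (v : Fin n → ℝ) (j : Fin n) (k : ℕ) :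
    leaveOutIterate (-W) v j k = (-1 : ℝ) ^ k • leaveOutIterate W v j k := by
  induction k with
  | zero => simp [leaveOutIterate]
  | succ k ih =>
    have h : leaveOut (-W) j = -leaveOut W j := by
      ext i l
      by_cases h : i = j ∨ l = j <;> simp [leaveOut, h]
    rw [leaveOutIterate, leaveOutIterate, ih, h, Matrix.neg_mulVec, Matrix.mulVec_smul, pow_succ]
    simp

/-- Lets a negative spike be treated, outcome by outcome, as a positive one with noise `-W`. -/
theorem IsControlled.neg {W : Matrix (Fin n) (Fin n) ℝ} {v : Fin n → ℝ} {B c : ℝ} {m : ℕ}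
    (h : IsControlled W v B c m) : IsControlled (-W) v B c m where
  opNorm x := by
    have h1 := l2norm_smul (-1) (W *ᵥ x)
    rw [Matrix.neg_mulVec, ← neg_one_smul ℝ, h1]
    simpa using h.opNorm x
  leaveOut j k hk := by
    rw [leaveOutIterate_neg, l2norm_smul, Matrix.mulVec_smul, Pi.smul_apply, smul_eq_mul, abs_mul,
      Matrix.neg_mulVec, Pi.neg_apply, abs_neg]
    simpa using h.leaveOut j k hk
  row a ha j := by
    rw [Matrix.neg_mulVec, Pi.neg_apply, abs_neg]; exact h.row a ha j
  quad a ha := by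
    rw [Matrix.neg_mulVec, dotProduct_neg, abs_neg]; exact h.quad a ha

theorem measure_biUnion_le_ofReal {Ω ι : Type*} [MeasurableSpace Ω] {P : Measure Ω} (s : Finset ι)
    (E : ι → Set Ω) {δ : ℝ} (h : ∀ i ∈ s, P (E i) ≤ ENNReal.ofReal δ) :
    P (⋃ i ∈ s, E i) ≤ ENNReal.ofReal (s.card * δ) := by
  refine (measure_biUnion_finset_le _ _).trans ((Finset.sum_le_sum h).trans ?_)
  rw [Finset.sum_const, nsmul_eq_mul, ENNReal.ofReal_mul (by positivity), ENNReal.ofReal_natCast]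

variable {Ω : Type*} [MeasurableSpace Ω] {P : Measure Ω} [IsProbabilityMeasure P] {σ : ℝ}
  {ν : ℝ≥0} {W : Ω → Matrix (Fin n) (Fin n) ℝ}

theorem exp_neg_mul_log (hn : 0 < n) (k : ℕ) :
    Real.exp (-(k * Real.log n)) = ((n : ℝ) ^ k)⁻¹ := by
  have hn' : (0 : ℝ) < n := by exact_mod_cast hn
  rw [Real.exp_neg, ← Real.log_pow, Real.exp_log (by positivity)]

/-- The operator norm of the noise, by a union bound over a grid of integer vectors. -/
theorem IsNoise.measure_not_opNorm_le (hW : IsNoise P σ ν W) (hn : 100 ≤ n) :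
    P {ω | ¬ ∀ x, l2norm (W ω *ᵥ x) ≤ 25 / 7 * √(4 * ν * (3 * n * Real.log n)) * l2norm x} ≤
      ENNReal.ofReal (2 * ((n : ℝ) ^ 8)⁻¹) := by
  have hn' : (100 : ℝ) ≤ n := by exact_mod_cast hn
  have hl0 : 0 ≤ Real.log n := Real.log_nonneg (by linarith)
  -- Large enough for the rounding when `n ≥ 100`, yet `2 * N + 1 ≤ n`, so the grid has at most `n ^
  -- n` points.
  set N := n / 4 with hNdef
  have hN : 2 * √(n : ℝ) + 1 / 2 ≤ N := by
    have h1 : (n : ℝ) ≤ 4 * N + 3 := by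
      have h2 : n ≤ 4 * N + 3 := by omega
      exact_mod_cast h2
    have h3 := Real.sq_sqrt (show (0 : ℝ) ≤ n by linarith)
    have h4 : 10 ≤ √(n : ℝ) := Real.le_sqrt_of_sq_le (by linarith)
    nlinarith
  let G : Finset (Fin n → ℤ) := Fintype.piFinset fun _ => Finset.Icc (-(N : ℤ)) N
  have hG : (G.card : ℝ) ≤ (n : ℝ) ^ n := by
    have h1 : G.card = (2 * N + 1) ^ n := by
      simp only [G, Fintype.card_piFinset, Int.card_Icc, Finset.prod_const, Finset.card_univ,
        Fintype.card_fin]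
      congr 1; omega
    rw [h1]
    have h2 : (2 * N + 1) ^ n ≤ n ^ n := Nat.pow_le_pow_left (by omega) n
    exact_mod_cast h2
  -- The tail is `n^(-3n)`: two factors `n^n` pay for pairs of grid points, and the third exceeds
  -- `n^8`.
  set s : ℝ := 3 * n * Real.log n with hs
  have hs0 : 0 ≤ s := by positivity
  let E : (Fin n → ℤ) × (Fin n → ℤ) → Set Ω := fun q => {ω | √(4 * ν * s) *
    (l2norm (fun i => (q.1 i : ℝ)) * l2norm (fun i => (q.2 i : ℝ))) <
      |(fun i => (q.1 i : ℝ)) ⬝ᵥ W ω *ᵥ (fun i => (q.2 i : ℝ))|}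
  have hsub : {ω | ¬ ∀ x, l2norm (W ω *ᵥ x) ≤ 25 / 7 * √(4 * ν * s) * l2norm x} ⊆
      ⋃ q ∈ G ×ˢ G, E q := by
    intro ω hω
    by_contra hcon
    refine hω (l2norm_mulVec_le_of_int hN (Real.sqrt_nonneg _) fun x y hx hy => ?_)
    by_contra hxy
    refine hcon (Set.mem_biUnion (x := (x, y)) ?_ (not_le.1 hxy))
    simp only [Finset.coe_product, Set.mem_prod, Finset.mem_coe, G, Fintype.mem_piFinset,
      Finset.mem_Icc]
    exact ⟨fun i => abs_le.1 (hx i), fun i => abs_le.1 (hy i)⟩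
  refine (measure_mono hsub).trans ((measure_biUnion_le_ofReal _ _ fun q _ =>
    hW.measure_lt_abs_bilin_le _ _ hs0).trans (ENNReal.ofReal_le_ofReal ?_))
  rw [Finset.card_product]
  push_cast
  have h1 : Real.exp (-s) ≤ ((n : ℝ) ^ n)⁻¹ * ((n : ℝ) ^ n)⁻¹ * ((n : ℝ) ^ 8)⁻¹ := by
    rw [← exp_neg_mul_log (by omega), ← exp_neg_mul_log (by omega), ← Real.exp_add,
      ← Real.exp_add, Real.exp_le_exp, hs]
    push_cast
    nlinarith
  have hpos : (0 : ℝ) < (n : ℝ) ^ n := by positivity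
  calc (G.card : ℝ) * G.card * (2 * Real.exp (-s))
      ≤ (n : ℝ) ^ n * (n : ℝ) ^ n *
        (2 * (((n : ℝ) ^ n)⁻¹ * ((n : ℝ) ^ n)⁻¹ * ((n : ℝ) ^ 8)⁻¹)) := by gcongr
    _ = 2 * ((n : ℝ) ^ 8)⁻¹ := by field_simp

/-- The last three families have at most `2 n ^ 2` events each, with tail `2 n^(-10)` per event. In
units of `n^(-8)` the four costs are `2 + 2 + 4 + 4 = 12`. The sign vectors are built from `v`,
hence deterministic. -/
theorem IsNoise.measure_not_isControlled_le (hW : IsNoise P σ ν W) (hn : 100 ≤ n)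
    (hlog : 1 ≤ Real.log (Real.log n)) (v : Fin n → ℝ) {m : ℕ} (hm : m ≤ n) :
    P {ω | ¬ IsControlled (W ω) v (25 / 7 * √(4 * ν * (3 * n * Real.log n)))
      (√(4 * ν * (10 * Real.log n))) m} ≤ ENNReal.ofReal (12 * ((n : ℝ) ^ 8)⁻¹) := by
  have hn' : (100 : ℝ) ≤ n := by exact_mod_cast hn
  have hl0 : 0 ≤ Real.log n := Real.log_nonneg (by linarith)
  obtain ⟨T, hT, hTc⟩ := exists_finset_levels (by omega) hlog
  set s : ℝ := 10 * Real.log n with hs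
  have hs0 : 0 ≤ s := by positivity
  set c := √(4 * ν * s) with hc
  have hc0 : 0 ≤ c := Real.sqrt_nonneg _
  have hexp : Real.exp (-s) = ((n : ℝ) ^ 10)⁻¹ := by
    rw [hs]; exact_mod_cast exp_neg_mul_log (n := n) (by omega) 10
  let E₁ : Set Ω := {ω | ¬ ∀ x, l2norm (W ω *ᵥ x) ≤
    25 / 7 * √(4 * ν * (3 * n * Real.log n)) * l2norm x}
  let E₂ : Fin n × ℕ → Set Ω := fun q => {ω | c * l2norm (leaveOutIterate (W ω) v q.1 q.2) <
    |(W ω *ᵥ leaveOutIterate (W ω) v q.1 q.2) q.1|}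
  let E₃ : ℝ × Fin n → Set Ω := fun q => {ω | c * l2norm (selectedSigns v q.1) <
    |(W ω *ᵥ selectedSigns v q.1) q.2|}
  let E₄ : ℝ → Set Ω := fun a => {ω | c * (l2norm (selectedSigns v a) *
    l2norm (selectedSigns v a)) < |selectedSigns v a ⬝ᵥ W ω *ᵥ selectedSigns v a|}
  have hsub : {ω | ¬ IsControlled (W ω) v (25 / 7 * √(4 * ν * (3 * n * Real.log n))) c m} ⊆
      E₁ ∪ (⋃ q ∈ Finset.univ ×ˢ Finset.range m, E₂ q) ∪
        (⋃ q ∈ T ×ˢ Finset.univ, E₃ q) ∪ ⋃ a ∈ T, E₄ a := by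
    intro ω hω
    by_contra hcon
    simp only [Set.mem_union, not_or, Set.mem_iUnion, not_exists] at hcon
    obtain ⟨⟨⟨h1, h2⟩, h3⟩, h4⟩ := hcon
    refine hω ⟨not_not.1 h1, fun j k hk => ?_, fun a ha j => ?_, fun a ha => ?_⟩
    · exact not_lt.1 (h2 (j, k) (by simpa using hk))
    · exact (not_lt.1 (h3 (a, j) (by simpa using hT ha))).trans
        (mul_le_mul_of_nonneg_left (l2norm_selectedSigns_le v a) hc0)
    · refine (not_lt.1 (h4 a (hT ha))).trans (mul_le_mul_of_nonneg_left ?_ hc0)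
      have h5 := l2norm_selectedSigns_le v a
      rw [← Real.mul_self_sqrt (Nat.cast_nonneg (largeEntries v a).card)]
      exact mul_le_mul h5 h5 (l2norm_nonneg _) (Real.sqrt_nonneg _)
  have hb1 : P E₁ ≤ ENNReal.ofReal (2 * ((n : ℝ) ^ 8)⁻¹) := hW.measure_not_opNorm_le hn
  have hb2 : P (⋃ q ∈ Finset.univ ×ˢ Finset.range m, E₂ q) ≤
      ENNReal.ofReal (2 * ((n : ℝ) ^ 8)⁻¹) := by
    refine (measure_biUnion_le_ofReal _ _ fun q _ =>
      hW.measure_lt_abs_leaveOutIterate_le v q.1 q.2 hs0).trans (ENNReal.ofReal_le_ofReal ?_)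
    rw [hexp, Finset.card_product, Finset.card_univ, Fintype.card_fin, Finset.card_range]
    have hm' : (m : ℝ) ≤ n := by exact_mod_cast hm
    push_cast
    calc (n : ℝ) * m * (2 * ((n : ℝ) ^ 10)⁻¹) ≤ n * n * (2 * ((n : ℝ) ^ 10)⁻¹) := by gcongr
      _ = 2 * ((n : ℝ) ^ 8)⁻¹ := by field_simp
  have hTc' : (T.card : ℝ) ≤ 2 * n := by
    have : T.card ≤ 2 * n := by omega
    exact_mod_cast this
  have hb3 : P (⋃ q ∈ T ×ˢ Finset.univ, E₃ q) ≤ ENNReal.ofReal (4 * ((n : ℝ) ^ 8)⁻¹) := by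
    refine (measure_biUnion_le_ofReal _ _ fun q _ =>
      hW.measure_lt_abs_mulVec_apply_le q.2 _ hs0).trans (ENNReal.ofReal_le_ofReal ?_)
    rw [hexp, Finset.card_product, Finset.card_univ, Fintype.card_fin]
    push_cast
    calc (T.card : ℝ) * n * (2 * ((n : ℝ) ^ 10)⁻¹) ≤ (2 * n) * n * (2 * ((n : ℝ) ^ 10)⁻¹) := by
          gcongr
      _ = 4 * ((n : ℝ) ^ 8)⁻¹ := by field_simp; norm_num
  have hb4 : P (⋃ a ∈ T, E₄ a) ≤ ENNReal.ofReal (4 * ((n : ℝ) ^ 8)⁻¹) := by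
    refine (measure_biUnion_le_ofReal _ _ fun a _ =>
      hW.measure_lt_abs_bilin_le _ _ hs0).trans (ENNReal.ofReal_le_ofReal ?_)
    rw [hexp]
    calc (T.card : ℝ) * (2 * ((n : ℝ) ^ 10)⁻¹) ≤ (2 * n) * n * (2 * ((n : ℝ) ^ 10)⁻¹) := by
          gcongr
          nlinarith
      _ = 4 * ((n : ℝ) ^ 8)⁻¹ := by field_simp; norm_num
  refine (measure_mono hsub).trans ((measure_union_le _ _).trans ((add_le_add ((measure_union_le
    _ _).trans (add_le_add ((measure_union_le _ _).trans (add_le_add hb1 hb2)) hb3)) hb4).trans ?_))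
  rw [← ENNReal.ofReal_add (by positivity) (by positivity),
    ← ENNReal.ofReal_add (by positivity) (by positivity),
    ← ENNReal.ofReal_add (by positivity) (by positivity)]
  refine ENNReal.ofReal_le_ofReal (le_of_eq (by ring))

end GoodEvent

/-! ### Deterministic analysis of the algorithm. -/

section Algorithm

variable {n : ℕ}

theorem observation_isSymm {lam : ℝ} {v : Fin n → ℝ} {W : Matrix (Fin n) (Fin n) ℝ}
    (hW : W.IsSymm) : (observation lam v W).IsSymm := by
  rw [observation, Matrix.IsSymm, Matrix.transpose_add, Matrix.transpose_smul,
    Matrix.transpose_vecMulVec, hW.eq]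

theorem observation_mulVec (lam : ℝ) (v : Fin n → ℝ) (W : Matrix (Fin n) (Fin n) ℝ)
    (x : Fin n → ℝ) : observation lam v W *ᵥ x = (lam * (v ⬝ᵥ x)) • v + W *ᵥ x := by
  rw [observation, Matrix.add_mulVec, Matrix.smul_mulVec, Matrix.vecMulVec_mulVec]
  ext i
  simp [mul_comm, mul_left_comm]

/-- The Rayleigh quotient at `v` gives `t ≥ lam - B ≥ (179/180) lam`, so denominators `t` become
`lam` at a cost of `180/179`. The choice of `m` turns the Neumann remainder into a term with a
factor `1/n`. -/
theorem IsTopEigenvector.exists_sign_abs_sub_le {W : Matrix (Fin n) (Fin n) ℝ} {u v : Fin n → ℝ}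
    {B c lam ε : ℝ} {m : ℕ} (hW : W.IsSymm) (hctl : IsControlled W v B c m)
    (hv : IsUnitVector v) (hlam : 0 < lam) (hB : 0 ≤ B) (hc : 0 ≤ c) (hε : ε ≤ 1)
    (hBlam : B ≤ ε / 180 * lam) (hm : (1 / 150 : ℝ) ^ m ≤ 1 / n)
    (hu : IsTopEigenvector (observation lam v W) u) :
    ∃ s : ℝ, (s = 1 ∨ s = -1) ∧ ∀ j, |u j - s * v j| ≤
      ε / 50 * |v j| + (1.04 * (c / lam) + 1.01 * (B / lam / n)) := by
  obtain ⟨hu1, t, ht, htop⟩ := hu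
  have hv1 := hv.l2norm_eq
  have heig : t • u = (lam * (v ⬝ᵥ u)) • v + W *ᵥ u := by
    rw [← observation_mulVec]
    have h := Module.End.mem_eigenspace_iff.1 ht.1
    rw [Matrix.toLin'_apply] at h
    exact h.symm
  have htge : lam - B ≤ t := by
    have h := dotProduct_mulVec_le_of_eigenvalues_le (observation_isSymm hW) htop hv1
    rw [observation_mulVec, dotProduct_add, dotProduct_smul, dotProduct_self_eq, hv1] at h
    have h2 : |v ⬝ᵥ W *ᵥ v| ≤ B := by
      refine (abs_dotProduct_le _ _).trans ?_
      have := hctl.opNorm v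
      rw [hv1] at *
      linarith
    have h3 := (abs_le.1 h2).1
    simp only [smul_eq_mul] at h
    linarith
  have ht1 : 179 / 180 * lam ≤ t := by nlinarith
  have ht0 : 0 < t := by linarith
  have hBt1 : B / t ≤ 180 / 179 * (B / lam) := by
    rw [div_le_iff₀ ht0]
    calc B = 180 / 179 * (B / lam) * (179 / 180 * lam) := by field_simp
      _ ≤ _ := by gcongr
  have hBl : B / lam ≤ ε / 180 := by rwa [div_le_iff₀ hlam]
  have hct : c / t ≤ 180 / 179 * (c / lam) := by
    rw [div_le_iff₀ ht0]
    calc c = 180 / 179 * (c / lam) * (179 / 180 * lam) := by field_simp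
      _ ≤ _ := by gcongr
  have hBt : B / t ≤ 1 / 150 := by linarith
  have hBt0 : 0 ≤ B / t := by positivity
  obtain ⟨s, hs, hsj⟩ := SpikedMatrix.exists_sign_abs_sub_le ht0 hB hc hBt hctl.opNorm hu1.l2norm_eq
    hv1 heig hctl.leaveOut
  refine ⟨s, hs, fun j => (hsj j).trans ?_⟩
  have hlast : (B / t) ^ (m + 1) ≤ 1.01 * (B / lam / n) := by
    have h1 : 0 ≤ B / lam := by positivity
    calc (B / t) ^ (m + 1) = (B / t) ^ m * (B / t) := pow_succ _ _
      _ ≤ 1 / n * (180 / 179 * (B / lam)) := by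
          have h2 := pow_le_pow_left₀ hBt0 hBt m
          exact mul_le_mul (h2.trans hm) hBt1 hBt0 (by positivity)
      _ = 180 / 179 * (B / lam / n) := by ring
      _ ≤ 1.01 * (B / lam / n) := by
          have : 0 ≤ B / lam / n := by positivity
          nlinarith
  have hfirst : 3 * (B / t) * |v j| ≤ ε / 50 * |v j| := by
    have := abs_nonneg (v j)
    have h0 : 3 * (B / t) ≤ ε / 50 := by
      have : 0 ≤ B / lam := by positivity
      linarith
    gcongr
  have hc0 : 0 ≤ c / lam := by positivity
  linarith

theorem abs_abs_sub_abs_le {s x y : ℝ} (hs : s = 1 ∨ s = -1) : |(|x| - |y|)| ≤ |x - s * y| := by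
  have h : |s * y| = |y| := by rcases hs with rfl | rfl <;> simp
  rw [← h]; exact abs_abs_sub_abs_le_abs_sub _ _

/-- Near the threshold the perturbation moves absolute values by far less than `ε a / 2`, so half of
the gap remains. -/
theorem largeEntries_eq_and_gap {u v : Fin n → ℝ} {s ε a e : ℝ} (hε : 0 < ε) (hε1 : ε ≤ 1)
    (hs : s = 1 ∨ s = -1) (ha : 0 < a) (he : e ≤ ε / 200 * a)
    (hclose : ∀ j, |u j - s * v j| ≤ ε / 50 * |v j| + e)
    (hgap : ∀ i, |v i| ∉ Set.Icc ((1 - ε) * a) ((1 + ε) * a)) :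
    largeEntries u a = largeEntries v a ∧
      ∀ i, |u i| ∉ Set.Ioo ((1 - ε / 2) * a) ((1 + ε / 2) * a) := by
  have hεa : 0 < ε * a := by positivity
  have hdich : ∀ i, (a ≤ |v i| ∧ (1 + ε / 2) * a ≤ |u i|) ∨
      (|v i| < a ∧ |u i| ≤ (1 - ε / 2) * a) := by
    intro i
    have h1 := abs_le.1 ((abs_abs_sub_abs_le hs).trans (hclose i))
    have h2 := hgap i
    rw [Set.mem_Icc, not_and_or, not_le, not_le] at h2
    rcases h2 with h2 | h2
    · right; constructor <;> nlinarith
    · left; constructor <;> nlinarith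
  constructor
  · ext i
    simp only [largeEntries, Finset.mem_filter, Finset.mem_univ, true_and]
    rcases hdich i with ⟨h1, h2⟩ | ⟨h1, h2⟩
    · exact ⟨fun _ => h1, fun _ => by nlinarith⟩
    · exact ⟨fun h => by nlinarith, fun h => by linarith⟩
  · rintro i ⟨h3, h4⟩
    rcases hdich i with ⟨h1, h2⟩ | ⟨h1, h2⟩ <;> linarith

/-- Here the gap is that of `u`, and `v` need not have one at `a`. This covers every threshold the
algorithm may pick and replaces a data-dependent index set by a deterministic one. -/
theorem largeEntries_eq_of_gap {u v : Fin n → ℝ} {s ε a e : ℝ} (hε : 0 < ε) (hε1 : ε ≤ 1)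
    (hs : s = 1 ∨ s = -1) (ha : 0 < a) (he : e ≤ ε / 200 * a)
    (hclose : ∀ j, |u j - s * v j| ≤ ε / 50 * |v j| + e)
    (hgap : ∀ i, |u i| ∉ Set.Ioo ((1 - ε / 2) * a) ((1 + ε / 2) * a)) :
    largeEntries u a = largeEntries v a := by
  have hεa : 0 < ε * a := by positivity
  ext i
  simp only [largeEntries, Finset.mem_filter, Finset.mem_univ, true_and]
  have h1 := abs_le.1 ((abs_abs_sub_abs_le hs).trans (hclose i))
  have h2 := hgap i
  rw [Set.mem_Ioo, not_and_or, not_lt, not_lt] at h2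
  rcases h2 with h2 | h2
  · constructor <;> intro h <;> nlinarith
  · constructor <;> intro h <;> nlinarith

theorem sign_eq_of_close {s ε a e x y : ℝ} (hε1 : ε ≤ 1)
    (hs : s = 1 ∨ s = -1) (ha : 0 < a) (he : e ≤ ε / 200 * a)
    (hclose : |x - s * y| ≤ ε / 50 * |y| + e) (hy : a ≤ |y|) :
    Real.sign x = s * Real.sign y := by
  have h1 : |x - s * y| < |y| := by nlinarith
  have h2 := abs_lt.1 h1
  rcases lt_trichotomy y 0 with h | h | h
  · rw [abs_of_neg h] at h2
    rw [Real.sign_of_neg h]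
    rcases hs with rfl | rfl
    · rw [Real.sign_of_neg (by linarith)]; norm_num
    · rw [Real.sign_of_pos (by linarith)]; norm_num
  · subst h; simp at hy; linarith
  · rw [abs_of_pos h] at h2
    rw [Real.sign_of_pos h]
    rcases hs with rfl | rfl
    · rw [Real.sign_of_pos (by linarith)]; norm_num
    · rw [Real.sign_of_neg (by linarith)]; norm_num

/-- Sensitivity of a normalized quotient whose denominator is `√(S) √(μ)` with `S ≈ λ A²` and
`μ ≈ λ`. -/
theorem abs_quotient_sub_le {lam lh A Q w y x₀ y₀ w₀ : ℝ} (hlam : 0 < lam) (hA : 0 < A)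
    (hQ : |Q| ≤ x₀ * (lam * A ^ 2)) (hlh : |lh - lam| ≤ y₀ * lam) (hw : |w| ≤ w₀ * (lam * A))
    (hx₀ : x₀ ≤ 1 / 2) (hy₀ : y₀ ≤ 1 / 2) (hy : |y| ≤ 1) :
    0 < lam * A ^ 2 + Q ∧
      |(lam * y * A + w) / (√(lam * A ^ 2 + Q) * √lh) - y| ≤ 3 * (x₀ + y₀) + 2 * w₀ := by
  have hlA : 0 < lam * A ^ 2 := by positivity
  have hQ' := abs_le.1 hQ
  have hlh' := abs_le.1 hlh
  have hx0 : 0 ≤ x₀ := by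
    by_contra h
    have := mul_neg_of_neg_of_pos (not_le.1 h) hlA
    linarith [abs_nonneg Q]
  have hy0 : 0 ≤ y₀ := by
    by_contra h
    have := mul_neg_of_neg_of_pos (not_le.1 h) hlam
    linarith [abs_nonneg (lh - lam)]
  have hw0 : 0 ≤ w₀ := by
    by_contra h
    have := mul_neg_of_neg_of_pos (not_le.1 h) (mul_pos hlam hA)
    linarith [abs_nonneg w]
  have hS : 1 / 2 * (lam * A ^ 2) ≤ lam * A ^ 2 + Q := by nlinarith
  have hlh1 : 1 / 2 * lam ≤ lh := by nlinarith
  have hS0 : 0 < lam * A ^ 2 + Q := by linarith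
  have hlh0 : 0 < lh := by linarith
  refine ⟨hS0, ?_⟩
  set S := lam * A ^ 2 + Q with hSdef
  set D := √S * √lh with hD
  have hD0 : 0 < D := by positivity
  have hD2 : D ^ 2 = S * lh := by
    rw [hD, mul_pow, Real.sq_sqrt hS0.le, Real.sq_sqrt hlh0.le]
  set M := lam * A with hM
  have hM0 : 0 < M := by positivity
  have hDM : 1 / 2 * M ≤ D := by
    refine le_of_sq_le_sq ?_ hD0.le
    rw [hD2]
    calc (1 / 2 * M) ^ 2 = (1 / 2 * (lam * A ^ 2)) * (1 / 2 * lam) := by rw [hM]; ring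
      _ ≤ S * lh := by gcongr
  have hdiff : |M ^ 2 - D ^ 2| ≤ (x₀ + y₀ + x₀ * y₀) * M ^ 2 := by
    have h1 : M ^ 2 - D ^ 2 = -(Q * lam + lam * A ^ 2 * (lh - lam) + Q * (lh - lam)) := by
      rw [hD2, hSdef, hM]; ring
    rw [h1, abs_neg]
    calc _ ≤ |Q| * lam + lam * A ^ 2 * |lh - lam| + |Q| * |lh - lam| := by
          refine (abs_add_le _ _).trans (add_le_add ((abs_add_le _ _).trans (add_le_add ?_ ?_)) ?_)
          · rw [abs_mul, abs_of_pos hlam]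
          · rw [abs_mul, abs_of_pos hlA]
          · rw [abs_mul]
      _ ≤ x₀ * (lam * A ^ 2) * lam + lam * A ^ 2 * (y₀ * lam) +
            x₀ * (lam * A ^ 2) * (y₀ * lam) := by gcongr
      _ = _ := by rw [hM]; ring
  -- Squares avoid differentiating the root: `|M - D| = |M ^ 2 - D ^ 2| / (M + D)`, and `D ≥ M / 2`
  -- absorbs the constants.
  have hratio : |M - D| ≤ 2 * (x₀ + y₀) * D := by
    have h1 : |M ^ 2 - D ^ 2| = |M - D| * (M + D) := by
      rw [sq_sub_sq, abs_mul, abs_of_pos (by positivity)]; ring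
    have h2 : x₀ + y₀ + x₀ * y₀ ≤ 5 / 4 * (x₀ + y₀) := by nlinarith
    have h3 : |M - D| * (M + D) ≤ 5 / 4 * (x₀ + y₀) * M ^ 2 := by
      rw [← h1]; exact hdiff.trans (by gcongr)
    have h4 : 5 / 4 * (x₀ + y₀) * M ^ 2 ≤ 2 * (x₀ + y₀) * D * (M + D) := by
      have h5 : 5 / 4 * M ^ 2 ≤ 2 * (D * (M + D)) := by nlinarith
      have h6 := mul_le_mul_of_nonneg_left h5 (add_nonneg hx0 hy0)
      linarith
    exact le_of_mul_le_mul_right (h3.trans h4) (by positivity)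
  have hexp : (lam * y * A + w) / D - y = y * ((M - D) / D) + w / D := by
    rw [hM]; field_simp; ring
  have h1 : |(M - D) / D| ≤ 3 * (x₀ + y₀) := by
    rw [abs_div, abs_of_pos hD0, div_le_iff₀ hD0]
    refine hratio.trans ?_
    gcongr; norm_num
  have h2 : |w / D| ≤ 2 * w₀ := by
    rw [abs_div, abs_of_pos hD0, div_le_iff₀ hD0]
    refine hw.trans ?_
    nlinarith
  rw [hexp]
  refine (abs_add_le _ _).trans (add_le_add ?_ h2)
  rw [abs_mul]
  calc |y| * |(M - D) / D| ≤ 1 * (3 * (x₀ + y₀)) := by gcongr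
    _ = _ := one_mul _

/-- The refined estimate is entrywise close to `± v` as soon as the selected index set and the
selected signs are those of `v`. -/
theorem refined_close {W : Matrix (Fin n) (Fin n) ℝ} {u v : Fin n → ℝ}
    {B c lam lh s a l d : ℝ} {m : ℕ} (hctl : IsControlled W v B c m)
    (hv : IsUnitVector v) (hlam : 0 < lam) (hc : 0 ≤ c) (hs : s = 1 ∨ s = -1) (ha : 0 < a)
    (hal : a ∈ levels n) (hl : 1 ≤ l) (hI : largeEntries u a = largeEntries v a)
    (hsign : ∀ k ∈ largeEntries v a, Real.sign (u k) = s * Real.sign (v k))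
    (hcard : 1 / (a ^ 2 * l ^ 2) ≤ ((largeEntries u a).card : ℝ))
    (hcl : c * l ^ 2 ≤ 1 / 2 * lam) (hd : d ≤ 1 / 2 * lam) (hlh : |lh - lam| ≤ d) :
    0 < selectedSum (observation lam v W) lh u a ∧
    ∀ j, |signs u a j * refined (observation lam v W) lh u a j - s * v j| ≤
      3 * (c * l ^ 2 / lam + d / lam) + 2 * (c * l / lam) := by
  have hlh0 : 0 < lh := by have := (abs_le.1 hlh).1; linarith
  have hss : s * s = 1 := by rcases hs with rfl | rfl <;> norm_num
  set I := largeEntries v a with hIdef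
  set g := selectedSigns v a with hg
  set A := v ⬝ᵥ g with hA
  set K : ℝ := (I.card : ℝ) with hK
  have hgI : ∀ k ∈ I, g k = Real.sign (v k) := fun k hk => by
    simp only [hg, selectedSigns, ← hIdef, hk, if_true]
  have hsum : ∀ x : Fin n → ℝ, ∑ k ∈ I, x k * Real.sign (v k) = x ⬝ᵥ g := by
    intro x
    simp only [dotProduct, hg, selectedSigns, ← hIdef, mul_ite, mul_zero]
    rw [← Finset.sum_filter]; simp
  have hsignsI : ∀ k ∈ I, signs u a k = s * Real.sign (v k) := fun k hk => by
    simp only [signs, hI, hk, if_true, hsign k hk]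
  have hvpos : ∀ k ∈ I, a ≤ |v k| := fun k hk => by
    simpa [hIdef, largeEntries] using hk
  have hsgn2 : ∀ k ∈ I, Real.sign (v k) * Real.sign (v k) = 1 := fun k hk => by
    rcases lt_trichotomy (v k) 0 with h | h | h
    · rw [Real.sign_of_neg h]; norm_num
    · have := hvpos k hk; rw [h, abs_zero] at this; linarith
    · rw [Real.sign_of_pos h]; norm_num
  have hsigns2 : ∀ j, signs u a j * signs u a j = 1 := fun j => by
    by_cases hj : j ∈ I
    · rw [hsignsI j hj, mul_mul_mul_comm, hss, hsgn2 j hj, one_mul]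
    · simp [signs, hI, hj]
  have horient : orient (observation lam v W) lh = observation lam v W := by
    simp [orient, not_lt.2 hlh0.le]
  have hrow : ∀ j, ∑ k ∈ I, conjugated (observation lam v W) lh u a j k =
      signs u a j * s * (lam * v j * A + (W *ᵥ g) j) := by
    intro j
    have h1 : ∀ k ∈ I, conjugated (observation lam v W) lh u a j k =
        signs u a j * s * (observation lam v W j k * Real.sign (v k)) := by
      intro k hk
      rw [conjugated, horient, Matrix.mul_diagonal, Matrix.diagonal_mul, hsignsI k hk]; ring
    rw [Finset.sum_congr rfl h1, ← Finset.mul_sum, hsum]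
    congr 1
    have h2 := congrFun (observation_mulVec lam v W g) j
    simp only [Pi.add_apply, Pi.smul_apply, smul_eq_mul] at h2
    change (observation lam v W *ᵥ g) j = _
    rw [h2]; ring
  have hS : selectedSum (observation lam v W) lh u a = lam * A ^ 2 + g ⬝ᵥ W *ᵥ g := by
    rw [selectedSum, hI]
    have h1 : ∀ j ∈ I, ∑ k ∈ I, conjugated (observation lam v W) lh u a j k =
        lam * A * (v j * Real.sign (v j)) + (W *ᵥ g) j * Real.sign (v j) := by
      intro j hj
      rw [hrow, hsignsI j hj]
      linear_combination (Real.sign (v j) * (lam * v j * A + (W *ᵥ g) j)) * hss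
    rw [Finset.sum_congr rfl h1, Finset.sum_add_distrib, ← Finset.mul_sum, hsum, hsum,
      dotProduct_comm (W *ᵥ g) g]
    ring
  have hl2 : 0 < a ^ 2 * l ^ 2 := by positivity
  rw [hI] at hcard
  have hK1 : 1 ≤ K * (a ^ 2 * l ^ 2) := (div_le_iff₀ hl2).1 hcard
  have hK0 : 0 < K := by
    by_contra h
    have := mul_nonpos_of_nonpos_of_nonneg (not_lt.1 h) hl2.le
    linarith
  -- `A` is the sum of `|v k|` over the selected indices, each at least `a`. With `hK1` this gives
  -- `K ≤ l ^ 2 * A ^ 2`, which turns the noise bounds `c * K` and `c * √K` into relative errors.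
  have hAge : K * a ≤ A := by
    rw [hA, ← hsum, hK, ← nsmul_eq_mul]
    refine Finset.card_nsmul_le_sum _ _ _ fun k hk => ?_
    refine (hvpos k hk).trans (le_of_eq ?_)
    rcases lt_trichotomy (v k) 0 with h | h | h
    · rw [Real.sign_of_neg h, abs_of_neg h]; ring
    · rw [h]; simp
    · rw [Real.sign_of_pos h, abs_of_pos h]; ring
  have hKa : 0 < K * a := by positivity
  have hA0 : 0 < A := by linarith
  have hQ : |g ⬝ᵥ W *ᵥ g| ≤ c * l ^ 2 / lam * (lam * A ^ 2) := by
    refine (hctl.quad a hal).trans ?_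
    rw [show c * l ^ 2 / lam * (lam * A ^ 2) = c * (l ^ 2 * A ^ 2) by field_simp]
    refine mul_le_mul_of_nonneg_left ?_ hc
    calc K ≤ K * (K * (a ^ 2 * l ^ 2)) := le_mul_of_one_le_right hK0.le hK1
      _ = l ^ 2 * (K * a) ^ 2 := by ring
      _ ≤ l ^ 2 * A ^ 2 := by gcongr
  have hw : ∀ j, |(W *ᵥ g) j| ≤ c * l / lam * (lam * A) := by
    intro j
    refine (hctl.row a hal j).trans ?_
    rw [show c * l / lam * (lam * A) = c * (l * A) by field_simp]
    refine mul_le_mul_of_nonneg_left ?_ hc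
    refine (Real.sqrt_le_iff.2 ⟨by positivity, ?_⟩ : √K ≤ l * (K * a)).trans (by gcongr)
    calc K ≤ K * (K * (a ^ 2 * l ^ 2)) := le_mul_of_one_le_right hK0.le hK1
      _ = (l * (K * a)) ^ 2 := by ring
  have hlh' : |lh - lam| ≤ d / lam * lam := by rwa [div_mul_cancel₀ _ hlam.ne']
  have hsv : ∀ j, |v j| ≤ 1 := fun j => by
    have := abs_apply_le_l2norm v j; rwa [hv.l2norm_eq] at this
  have hmain := fun j => abs_quotient_sub_le hlam hA0 hQ hlh' (hw j)
    (by rwa [div_le_iff₀ hlam]) (by rwa [div_le_iff₀ hlam]) (hsv j)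
  rw [hS]
  -- The positivity half of `hmain` does not involve `j`, but extracting it requires some index.
  have hn : 0 < n := by
    have h1 : I.Nonempty := Finset.card_pos.1 (by rw [hK] at hK0; exact_mod_cast hK0)
    exact lt_of_le_of_lt (Nat.zero_le _) h1.choose.2
  refine ⟨(hmain ⟨0, hn⟩).1, fun j => ?_⟩
  have hrj : signs u a j * refined (observation lam v W) lh u a j =
      s * ((lam * v j * A + (W *ᵥ g) j) / (√(lam * A ^ 2 + g ⬝ᵥ W *ᵥ g) * √lh)) := by
    rw [refined, hS, hI, hrow, abs_of_pos hlh0]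
    rw [← mul_div_assoc, ← mul_assoc, ← mul_assoc, hsigns2 j, one_mul, mul_div_assoc]
  rw [hrj, ← mul_sub, abs_mul]
  have habs : |s| = 1 := by rcases hs with rfl | rfl <;> simp
  rw [habs, one_mul]
  exact (hmain j).2

theorem dInf_le_of_sign {x y : Fin n → ℝ} {s r : ℝ} (hs : s = 1 ∨ s = -1) (hr : 0 ≤ r)
    (h : ∀ j, |x j - s * y j| ≤ r) : dInf x y ≤ r := by
  rcases hs with rfl | rfl
  · refine min_le_of_left_le ((pi_norm_le_iff_of_nonneg hr).2 fun j => ?_)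
    rw [Pi.sub_apply, Real.norm_eq_abs, abs_sub_comm]
    simpa using h j
  · refine min_le_of_right_le ((pi_norm_le_iff_of_nonneg hr).2 fun j => ?_)
    rw [Pi.add_apply, Real.norm_eq_abs, add_comm]
    simpa using h j

/-- The deterministic guarantee of the algorithm on a controlled noise matrix. -/
theorem runsWithin_of_isControlled {W : Matrix (Fin n) (Fin n) ℝ} {v : Fin n → ℝ}
    {B c lam lh ε σ d e r : ℝ} {m : ℕ} (hn : 2 ≤ n) (hlog : 1 ≤ Real.log (Real.log n))
    (hl : 1 ≤ Real.log n) (hW : W.IsSymm)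
    (hctl : IsControlled W v B c m) (hv : IsUnitVector v) (hgap : HasEntryGap ε v)
    (hlam : 0 < lam) (hB : 0 ≤ B) (hc : 0 ≤ c) (hσ : 0 ≤ σ) (hε : 0 < ε) (hε1 : ε ≤ 1)
    (hBlam : B ≤ ε / 180 * lam) (hm : (1 / 150 : ℝ) ^ m ≤ 1 / n)
    (he : 1.04 * (c / lam) + 1.01 * (B / lam / n) ≤ e) (hea : e ≤ ε / 200 * (1 / √(2 * n)))
    (hcl : c * Real.log n ^ 2 ≤ 1 / 2 * lam) (hd : d ≤ 1 / 2 * lam) (hlh : |lh - lam| ≤ d)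
    (hr1 : 2 * (σ * Real.log n / lam) + 2 * e ≤ r)
    (hr2 : 3 * (c * Real.log n ^ 2 / lam + d / lam) + 2 * (c * Real.log n / lam) ≤ r) :
    RunsWithin σ (ε / 2) (observation lam v W) lh v r := by
  have hlh1 : 1 / 2 * lam ≤ lh := by have := (abs_le.1 hlh).1; linarith
  have hlh0 : 0 < lh := by linarith
  have horient : orient (observation lam v W) lh = observation lam v W := by
    simp [orient, not_lt.2 hlh0.le]
  have hn' : (2 : ℝ) ≤ n := by exact_mod_cast hn
  have hapos : ∀ a ∈ levels n, 0 < a := fun a ha =>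
    lt_of_lt_of_le (by positivity) (one_div_sqrt_le_of_mem_levels hn hlog ha)
  have hele : ∀ a ∈ levels n, e ≤ ε / 200 * a := fun a ha =>
    hea.trans (mul_le_mul_of_nonneg_left (one_div_sqrt_le_of_mem_levels hn hlog ha) (by positivity))
  have he0 : 0 ≤ e := le_trans (by positivity) he
  have hr0 : 0 ≤ r := le_trans (by positivity) hr1
  have hclose : ∀ u, IsTopEigenvector (observation lam v W) u → ∃ s : ℝ, (s = 1 ∨ s = -1) ∧
      ∀ j, |u j - s * v j| ≤ ε / 50 * |v j| + e := fun u hu => by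
    obtain ⟨s, hs, h⟩ := hu.exists_sign_abs_sub_le hW hctl hv hlam hB hc hε1 hBlam hm
    exact ⟨s, hs, fun j => (h j).trans (by linarith)⟩
  have hrefined : ∀ u a s, (s = 1 ∨ s = -1) → (∀ j, |u j - s * v j| ≤ ε / 50 * |v j| + e) →
      IsAdmissible (ε / 2) u a → 0 < selectedSum (observation lam v W) lh u a ∧
      ∀ j, |signs u a j * refined (observation lam v W) lh u a j - s * v j| ≤ r := by
    intro u a s hs hus hadm
    have ha := hapos a hadm.mem
    have hI := largeEntries_eq_of_gap hε hε1 hs ha (hele a hadm.mem) hus hadm.gap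
    have h := refined_close hctl hv hlam hc hs ha hadm.mem hl hI
      (fun k hk => sign_eq_of_close hε1 hs ha (hele a hadm.mem) (hus k)
        (by simpa [largeEntries] using hk)) hadm.card_ge hcl hd hlh
    exact ⟨h.1, fun j => (h.2 j).trans hr2⟩
  refine ⟨hlh0.ne', ?_, ?_, ?_, ?_⟩
  · rw [horient]; exact exists_isTopEigenvector (observation_isSymm hW) (by omega)
  · rw [horient]
    intro u hu
    obtain ⟨s, hs, hus⟩ := hclose u hu
    obtain ⟨a, ha, -, hcard, hg⟩ := hgap
    obtain ⟨hI, hg'⟩ := largeEntries_eq_and_gap hε hε1 hs (hapos a ha) (hele a ha) hus hg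
    exact ⟨a, ha, by rw [hI]; exact hcard.le, hg'⟩
  · rw [horient]
    intro u a hu hadm
    obtain ⟨s, hs, hus⟩ := hclose u hu
    exact (hrefined u a s hs hus hadm).1
  · rw [horient]
    intro u a hu hadm
    obtain ⟨s, hs, hus⟩ := hclose u hu
    refine dInf_le_of_sign hs hr0 fun j => ?_
    rw [output]
    split_ifs with hj
    · refine le_trans ?_ hr1
      -- Closeness is read backwards: a small `|u j|` forces a small `|v j|`, so the relative error
      -- term is small too.
      have h1 := (abs_le.1 ((abs_abs_sub_abs_le hs).trans (hus j))).1
      have h2 : |u j| ≤ 2 * (σ * Real.log n / lam) := by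
        refine hj.trans ?_
        rw [abs_of_pos hlh0, div_mul_eq_mul_div, ← mul_div_assoc, div_le_div_iff₀ hlh0 hlam]
        have : 0 ≤ σ * Real.log n := by positivity
        nlinarith
      have h3 : ε / 50 * |v j| ≤ 1 / 50 * |v j| := by gcongr
      have := hus j
      have := abs_nonneg (u j)
      linarith
    · exact (hrefined u a s hs hus hadm).2 j

/-- For `lh ≠ 0`, `orient` returns the same matrix on both inputs, and the rest depends on `lh` only
through `|lh|`. -/
theorem RunsWithin.of_neg {σ β lh r : ℝ} {Y : Matrix (Fin n) (Fin n) ℝ} {v : Fin n → ℝ}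
    (h : RunsWithin σ β (-Y) (-lh) v r) : RunsWithin σ β Y lh v r := by
  have hlh : lh ≠ 0 := neg_ne_zero.1 h.estimate_ne_zero
  have horient : orient (-Y) (-lh) = orient Y lh := by
    unfold orient
    rcases lt_or_gt_of_ne hlh with h | h
    · rw [if_pos h, if_neg (by linarith)]
    · rw [if_pos (by linarith), if_neg (by linarith), neg_neg]
  have hconj : ∀ u a, conjugated (-Y) (-lh) u a = conjugated Y lh u a := fun u a => by
    rw [conjugated, conjugated, horient]
  have hsel : ∀ u a, selectedSum (-Y) (-lh) u a = selectedSum Y lh u a := fun u a => by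
    rw [selectedSum, selectedSum, hconj]
  have hout : ∀ u a, output σ (-Y) (-lh) u a = output σ Y lh u a := fun u a => by
    ext j
    rw [output, output, refined, refined, hsel, hconj, abs_neg]
  obtain ⟨-, h1, h2, h3, h4⟩ := h
  simp only [horient, hsel, hout] at h1 h2 h3 h4
  exact ⟨hlh, h1, h2, h3, h4⟩

end Algorithm

/-! ### Constants, scales and the final probability bound. -/

section Main

variable {n : ℕ}

theorem exists_forall_ge_log_sq_le (D : ℝ) : ∃ n₀ : ℕ, ∀ n : ℕ, n₀ ≤ n →
    100 ≤ n ∧ 1 ≤ Real.log (Real.log n) ∧ D * Real.log n ^ 2 ≤ √(n : ℝ) := by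
  rw [← Filter.eventually_atTop]
  have hcast := tendsto_natCast_atTop_atTop (R := ℝ)
  have h2 : ∀ᶠ n : ℕ in Filter.atTop, 1 ≤ Real.log (Real.log n) :=
    (Real.tendsto_log_atTop.comp (Real.tendsto_log_atTop.comp hcast)).eventually_ge_atTop 1
  have h3 : ∀ᶠ x : ℝ in Filter.atTop,
      ‖Real.log x ^ (2 : ℝ)‖ ≤ (|D| + 1)⁻¹ * ‖x ^ (1 / 2 : ℝ)‖ :=
    (isLittleO_log_rpow_rpow_atTop 2 (by norm_num : (0 : ℝ) < 1 / 2)).bound (by positivity)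
  filter_upwards [Filter.eventually_ge_atTop 100, h2, hcast.eventually h3] with n h1 h2 h3
  refine ⟨h1, h2, ?_⟩
  rw [← Real.sqrt_eq_rpow, Real.norm_of_nonneg (Real.sqrt_nonneg _), Real.rpow_two,
    Real.norm_of_nonneg (sq_nonneg _), ← div_eq_inv_mul, le_div_iff₀ (by positivity)] at h3
  have h4 := le_abs_self D
  nlinarith [sq_nonneg (Real.log n)]

theorem IsNoise.le_sqrt {Ω : Type*} [MeasurableSpace Ω] {P : Measure Ω} [IsProbabilityMeasure P]
    {σ : ℝ} {ν : ℝ≥0} {W : Ω → Matrix (Fin n) (Fin n) ℝ} (hW : IsNoise P σ ν W) (hn : 0 < n) :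
    σ ≤ √(ν : ℝ) := by
  refine Real.le_sqrt_of_sq_le ?_
  rw [← hW.variance_eq ⟨0, hn⟩ ⟨0, hn⟩]
  exact variance_le_of_hasSubgaussianMGF (hW.subgaussian _ _)

set_option maxHeartbeats 800000 in
/-- The deterministic guarantee for a positive spike, at the scales of the noise model. -/
theorem runsWithin_of_pos {C₂ C₁ ε lam lh σ : ℝ} {ν : ℝ≥0} {W : Matrix (Fin n) (Fin n) ℝ}
    {v : Fin n → ℝ} (hn : 100 ≤ n) (hlog : 1 ≤ Real.log (Real.log n))
    (hn1 : Real.log n ^ 2 ≤ 100 * √(n : ℝ)) (hn2 : C₂ * Real.log n ^ 2 ≤ 1000 * √(n : ℝ))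
    (hC₂ : 0 < C₂) (hε : 0 < ε) (hε1 : ε ≤ 1) (hC₁ : 2400 / ε < C₁) (hlam : 0 < lam)
    (hlarge : C₁ * √((ν : ℝ) * n * Real.log n) ≤ lam) (hσ : 0 ≤ σ) (hσν : σ ≤ √(ν : ℝ))
    (hW : W.IsSymm) (hv : IsUnitVector v) (hgap : HasEntryGap ε v)
    (hctl : IsControlled W v (25 / 7 * √(4 * ν * (3 * n * Real.log n)))
      (√(4 * ν * (10 * Real.log n))) ⌈Real.log n⌉₊)
    (hlh : |lh - lam| ≤ C₂ * √(ν : ℝ) * Real.log n ^ (5 / 2 : ℝ)) :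
    RunsWithin σ (ε / 2) (observation lam v W) lh v
      ((3 * C₂ + 40) * √(ν : ℝ) * Real.log n ^ (5 / 2 : ℝ) / lam) := by
  have hn' : (100 : ℝ) ≤ n := by exact_mod_cast hn
  have hn0 : (0 : ℝ) < n := by linarith
  have hl0 : 0 < Real.log n := Real.log_pos (by linarith)
  have hl1 : 1 ≤ Real.log n := by
    by_contra h
    have := Real.log_nonpos hl0.le (not_le.1 h).le
    linarith
  have hm : (1 / 150 : ℝ) ^ ⌈Real.log n⌉₊ ≤ 1 / n := by
    have h1 : (1 / 150 : ℝ) ≤ Real.exp (-1) := by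
      rw [Real.exp_neg, one_div]
      exact inv_anti₀ (Real.exp_pos 1) (by linarith [Real.exp_one_lt_d9])
    calc (1 / 150 : ℝ) ^ ⌈Real.log n⌉₊ ≤ Real.exp (-1) ^ ⌈Real.log n⌉₊ := by gcongr
      _ = Real.exp (-⌈Real.log n⌉₊) := by rw [← Real.exp_nat_mul]; simp
      _ ≤ Real.exp (-Real.log n) := Real.exp_le_exp.2 (neg_le_neg (Nat.le_ceil _))
      _ = 1 / n := by rw [Real.exp_neg, Real.exp_log hn0, one_div]
  set l := Real.log n with hl
  set R := √(n : ℝ) with hR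
  set S := √((ν : ℝ) * l) with hS
  have hν0 : (0 : ℝ) ≤ ν := ν.2
  have hS0 : 0 ≤ S := Real.sqrt_nonneg _
  have hR10 : 10 ≤ R := Real.le_sqrt_of_sq_le (by linarith)
  have hR0 : 0 < R := by linarith
  have hRR : R * R = n := Real.mul_self_sqrt hn0.le
  have hνS : √(ν : ℝ) ≤ S := Real.sqrt_le_sqrt (by nlinarith)
  have hSR : √((ν : ℝ) * n * l) = S * R := by
    rw [hS, hR, ← Real.sqrt_mul (by positivity)]; congr 1; ring
  -- The target rate is `S * l ^ 2 / lam`: one factor `√l` belongs to the noise scale `S`, and `l ^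
  -- 2` comes from the cardinality condition.
  have hpow : √(ν : ℝ) * l ^ (5 / 2 : ℝ) = S * l ^ 2 := by
    rw [hS, Real.sqrt_mul hν0, show (5 / 2 : ℝ) = 1 / 2 + 2 by norm_num, Real.rpow_add hl0,
      ← Real.sqrt_eq_rpow, Real.rpow_two]; ring
  have hcS : √(4 * ν * (10 * l)) ≤ 6.33 * S := by
    rw [show 4 * (ν : ℝ) * (10 * l) = 40 * (ν * l) by ring, Real.sqrt_mul (by norm_num)]
    have : √40 ≤ 6.33 := Real.sqrt_le_iff.2 ⟨by norm_num, by norm_num⟩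
    gcongr
  have hBS : 25 / 7 * √(4 * ν * (3 * n * l)) ≤ 12.4 * (S * R) := by
    rw [show 4 * (ν : ℝ) * (3 * n * l) = 12 * (ν * n * l) by ring,
      Real.sqrt_mul (by norm_num), hSR]
    have : √12 ≤ 3.47 := Real.sqrt_le_iff.2 ⟨by norm_num, by norm_num⟩
    have h2 : 0 ≤ S * R := by positivity
    nlinarith
  have hSRlam : 2400 * (S * R) ≤ ε * lam := by
    rw [hSR] at hlarge
    have h1 : 2400 ≤ C₁ * ε := ((div_lt_iff₀ hε).1 hC₁).le
    calc 2400 * (S * R) ≤ C₁ * ε * (S * R) := by gcongr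
      _ = ε * (C₁ * (S * R)) := by ring
      _ ≤ ε * lam := by gcongr
  have hSRlam1 : 2400 * (S * R) ≤ lam := hSRlam.trans (mul_le_of_le_one_left hlam.le hε1)
  set B := 25 / 7 * √(4 * ν * (3 * n * l)) with hB
  set c := √(4 * ν * (10 * l)) with hc
  have hc0 : 0 ≤ c := Real.sqrt_nonneg _
  have hB0 : 0 ≤ B := by positivity
  clear_value B c S R
  have hBn : B / n ≤ 1.24 * S := by
    rw [div_le_iff₀ hn0, ← hRR]
    nlinarith [mul_nonneg hS0 hR0.le]
  have he : 1.04 * (c / lam) + 1.01 * (B / lam / n) ≤ 8 * (S / lam) := by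
    rw [div_right_comm]
    have h1 : c / lam ≤ 6.33 * (S / lam) := by rw [← mul_div_assoc]; gcongr
    have h2 : B / n / lam ≤ 1.24 * (S / lam) := by rw [← mul_div_assoc]; gcongr
    have h3 : 0 ≤ S / lam := by positivity
    linarith
  have hSl : S ≤ S * l ^ 2 := le_mul_of_one_le_right hS0 (one_le_pow₀ hl1)
  have hrhs : (3 * C₂ + 40) * √(ν : ℝ) * l ^ (5 / 2 : ℝ) / lam =
      (3 * C₂ + 40) * (S * l ^ 2 / lam) := by
    rw [mul_assoc, hpow, mul_div_assoc]
  rw [hrhs]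
  have hX0 : 0 ≤ S * l ^ 2 / lam := by positivity
  refine runsWithin_of_isControlled (e := 1.04 * (c / lam) + 1.01 * (B / lam / n))
    (d := C₂ * (S * l ^ 2)) (by omega) hlog hl1 hW hctl hv hgap hlam hB0 hc0 hσ hε hε1 ?_ hm
    le_rfl ?_ ?_ ?_ (by rwa [mul_assoc, hpow] at hlh) ?_ ?_
  · have := mul_pos hε hlam
    linarith
  -- The constant `2400` is used here: `1.04 · 6.33/2400 + 1.01/1800` must stay below `0.7/200 =
  -- 0.0035`.
  · have h1 : c / lam ≤ 6.33 / 2400 * (ε / R) := by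
      rw [div_le_iff₀ hlam]
      refine hcS.trans ?_
      have h2 : S ≤ ε * lam / (2400 * R) := by
        rw [le_div_iff₀ (by positivity)]; linarith
      calc 6.33 * S ≤ 6.33 * (ε * lam / (2400 * R)) := by gcongr
        _ = _ := by field_simp
    have h2 : B / lam / n ≤ 1 / 1800 * (ε / R) := by
      have h3 : B / lam ≤ ε / 180 := by
        rw [div_le_iff₀ hlam]
        have := mul_pos hε hlam
        linarith
      rw [div_le_iff₀ hn0, ← hRR]
      refine h3.trans ?_
      rw [show 1 / 1800 * (ε / R) * (R * R) = ε / 1800 * R by field_simp]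
      have := mul_le_mul_of_nonneg_left hR10 hε.le
      linarith
    have h3 : 0.7 / R ≤ 1 / √(2 * n) := by
      rw [Real.sqrt_mul (by norm_num), ← hR, div_le_div_iff₀ hR0 (by positivity)]
      have : √2 ≤ 1.4143 := Real.sqrt_le_iff.2 ⟨by norm_num, by norm_num⟩
      have := mul_le_mul_of_nonneg_right this hR0.le
      linarith
    have h4 : ε / 200 * (0.7 / R) ≤ ε / 200 * (1 / √(2 * n)) := by gcongr
    have h5 : ε / 200 * (0.7 / R) = 0.0035 * (ε / R) := by ring
    have h6 : 0 ≤ ε / R := by positivity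
    linarith
  · calc c * l ^ 2 ≤ 6.33 * S * (100 * R) := by gcongr
      _ ≤ 1 / 2 * lam := by linarith
  · calc C₂ * (S * l ^ 2) = S * (C₂ * l ^ 2) := by ring
      _ ≤ S * (1000 * R) := by gcongr
      _ ≤ 1 / 2 * lam := by linarith
  · have h1 : σ * l / lam ≤ S * l ^ 2 / lam := by
      have h2 : σ * l ≤ S * l ^ 2 := by
        exact mul_le_mul (hσν.trans hνS) (le_self_pow₀ hl1 two_ne_zero) hl0.le hS0
      gcongr
    have h2 : S / lam ≤ S * l ^ 2 / lam := by gcongr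
    have := mul_nonneg hC₂.le hX0
    linarith
  -- The total is `3 C₂ + 5 · 6.33` times the rate, within `3 C₂ + 40`.
  · have h1 : c * l ^ 2 / lam ≤ 6.33 * (S * l ^ 2 / lam) := by
      rw [← mul_div_assoc, ← mul_assoc]; gcongr
    have h2 : c * l / lam ≤ c * l ^ 2 / lam := by
      have : l ≤ l ^ 2 := le_self_pow₀ hl1 two_ne_zero
      gcongr
    rw [mul_div_assoc C₂]
    linarith

end Main

end SpikedMatrix

theorem theorem1 (C₂ : ℝ) (hC₂ : 0 < C₂) :
    ∃ C : ℝ, 0 < C ∧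
      ∀ ε₀ C₁ K : ℝ, 0 < ε₀ → ε₀ ≤ 1 → 2400 / ε₀ < C₁ → 0 < K →
      ∃ (K' : ℝ) (n₀ : ℕ), 0 < K' ∧ ∀ n : ℕ, n₀ ≤ n →
        ∀ (Ω : Type*) [MeasurableSpace Ω] (P : Measure Ω) [IsProbabilityMeasure P]
          (σ : ℝ) (ν : ℝ≥0) (W : Ω → Matrix (Fin n) (Fin n) ℝ)
          (lam : ℝ) (ustar : Fin n → ℝ) (lamHat : Ω → ℝ),
          0 ≤ σ →
          SpikedMatrix.IsNoise P σ ν W →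
          lam ≠ 0 →
          SpikedMatrix.IsUnitVector ustar →
          SpikedMatrix.HasEntryGap ε₀ ustar →
          C₁ * √((ν : ℝ) * n * Real.log n) ≤ |lam| →
          P {ω | ¬ |lamHat ω - lam| ≤ C₂ * √(ν : ℝ) * Real.log n ^ (5 / 2 : ℝ)}
            ≤ ENNReal.ofReal (K * ((n : ℝ) ^ 8)⁻¹ * Real.log n) →
          P {ω | ¬ SpikedMatrix.RunsWithin σ (ε₀ / 2)
                (SpikedMatrix.observation lam ustar (W ω)) (lamHat ω) ustar
                (C * √(ν : ℝ) * Real.log n ^ (5 / 2 : ℝ) / |lam|)}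
            ≤ ENNReal.ofReal (K' * ((n : ℝ) ^ 8)⁻¹ * Real.log n) := by
  refine ⟨3 * C₂ + 40, by positivity, fun ε₀ C₁ K hε hε1 hC₁ hK => ?_⟩
  obtain ⟨n₀, hn₀⟩ := SpikedMatrix.exists_forall_ge_log_sq_le (max 1 C₂)
  -- `K` pays for the eigenvalue estimate and `12` for the noise event; the latter lacks the factor
  -- `log n`, which is at least `1`.
  refine ⟨K + 12, n₀, by positivity, ?_⟩
  intro n hn Ω _ P _ σ ν W lam ustar lamHat hσ hW hlam hv hgap hlarge hhat
  obtain ⟨hn100, hlog, hsq⟩ := hn₀ n hn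
  have hn' : (100 : ℝ) ≤ n := by exact_mod_cast hn100
  have hl0 : 0 < Real.log n := Real.log_pos (by linarith)
  have hl1 : 1 ≤ Real.log n := by
    by_contra h
    have := Real.log_nonpos hl0.le (not_le.1 h).le
    linarith
  have hR : 0 ≤ √(n : ℝ) := Real.sqrt_nonneg _
  have hl2 := sq_nonneg (Real.log n)
  have hn1 : Real.log n ^ 2 ≤ 100 * √(n : ℝ) := by
    have := mul_le_mul_of_nonneg_right (le_max_left 1 C₂) hl2
    linarith
  have hn2 : C₂ * Real.log n ^ 2 ≤ 1000 * √(n : ℝ) := by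
    have := mul_le_mul_of_nonneg_right (le_max_right 1 C₂) hl2
    linarith
  have hm : ⌈Real.log n⌉₊ ≤ n :=
    Nat.ceil_le.2 ((Real.log_le_sub_one_of_pos (by linarith)).trans (by linarith))
  have hctl := hW.measure_not_isControlled_le hn100 hlog ustar hm
  have hσν := hW.le_sqrt (by omega)
  -- Off these two bad events the guarantee is deterministic, so `lamHat` may depend on the data
  -- arbitrarily. Monotonicity and subadditivity hold without measurability of the events.
  refine (measure_mono (t := {ω | ¬ |lamHat ω - lam| ≤ C₂ * √(ν : ℝ) * Real.log n ^ (5 / 2 : ℝ)} ∪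
    {ω | ¬ SpikedMatrix.IsControlled (W ω) ustar (25 / 7 * √(4 * ν * (3 * n * Real.log n)))
      (√(4 * ν * (10 * Real.log n))) ⌈Real.log n⌉₊}) ?_).trans
    ((measure_union_le _ _).trans ((add_le_add hhat hctl).trans ?_))
  · intro ω hω
    by_contra hcon
    simp only [Set.mem_union, Set.mem_ofPred_eq, not_or, not_not] at hcon
    obtain ⟨h1, h2⟩ := hcon
    refine hω ?_
    rcases lt_or_gt_of_ne hlam with hneg | hpos
    · have hobs : -SpikedMatrix.observation lam ustar (W ω) =
          SpikedMatrix.observation (-lam) ustar (-W ω) := by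
        rw [SpikedMatrix.observation, SpikedMatrix.observation, neg_add, neg_smul]
      refine SpikedMatrix.RunsWithin.of_neg ?_
      rw [hobs]
      rw [abs_of_neg hneg] at hlarge ⊢
      refine SpikedMatrix.runsWithin_of_pos hn100 hlog hn1 hn2 hC₂ hε hε1 hC₁ (neg_pos.2 hneg)
        hlarge hσ hσν (hW.symm ω).neg hv hgap h2.neg ?_
      rwa [neg_sub_neg, abs_sub_comm]
    · rw [abs_of_pos hpos] at hlarge ⊢
      exact SpikedMatrix.runsWithin_of_pos hn100 hlog hn1 hn2 hC₂ hε hε1 hC₁ hpos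
        hlarge hσ hσν (hW.symm ω) hv hgap h2 h1
  · rw [← ENNReal.ofReal_add (by positivity) (by positivity)]
    refine ENNReal.ofReal_le_ofReal ?_
    have h8 : 0 ≤ ((n : ℝ) ^ 8)⁻¹ := by positivity
    nlinarith
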